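/- Let $n\in\mathbb N$, $\Delta t>0$, $a_{m,i}\in\mathbb R$ ($1\le m\le l$) and $b_{ij}\ge 0$ ($i\ne j$, $1\le i,j\le n$). Let $x_1,\dots,x_n$ be jointly wide sense stationary (WSS) real processes in discrete time, driven by processes $p_1,\dots,p_n$ through the bilinear discretization of the dynamics $\sum_{m=1}^{l}a_{m,i}\frac{d^m x_i}{dt^m}=\sum_{j\ne i}b_{ij}(x_j-x_i)+p_i$, that is $$S_i(z)X_i(z)=\sum_{j\neq i}b_{ij}X_j(z)+P_i(z),\qquad S_i(z)=\sum_{m=1}^{l}a_{m,i}\Big(\frac{2(1-z^{-1})}{\Delta t(1+z^{-1})}\Big)^m+\sum_{j\ne i}b_{ij},$$ understood as the difference equation obtained by multiplying with $(1+z^{-1})^l$, where $z^{-1}$ is the delay by one step. Here the $p_i$ are zero mean and WSS, and $p_i$ and $p_j$ are uncorrelated for $i\ne j$. The correlation sequences of $x$ and of $p$ are absolutely summable, so that the power spectral densities $\Phi_X(\omega)=\sum_{k\in\mathbb Z}\mathbb E(x(k)x(0)^T)e^{-\hat{j}\omega k}$ and $\Phi_{p_i}(\omega)$ exist ($\hat{j}$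 is the imaginary unit), and $\Phi_{p_i}(\omega)>0$ for all $i$ and almost every $\omega\in[-\pi,\pi]$. Put $H_{ij}=b_{ij}/S_i$ for $i\neq j$ and $H_{ii}=0$. In the generative graph, $k$ is a child of $j$ if $H_{kj}\ne0$ almost everywhere on the unit circle; two nodes are neighbors if one of them is a child of the other. Let $i\neq j$ be strict spouses: they have a common child and are not neighbors. Let $W_j(e^{\hat{j}\omega})=\Phi_{x_jX_{\bar j}}(\omega)\Phi_{X_{\bar j}}(\omega)^{-1}$, with $X_{\bar j}=(x_r)_{r\ne j}$, be the non-causal multivariate Wiener filter that estimates $x_j$ from the other processes, and let $W_{ji}$ be its entry for $x_i$. Then: 1. $\angle W_{ji}(e^{\hat{j}\omega})=\pi$ at every $\omega\in[-\pi,\pi]$ at which $\Phi_X(\omega)$ is positive definite. 2. $\Phi_X(\omega)$ is positive definite at every $\omega\in(-\pi,\pi)$ at which $\Phi_{p_r}(\omega)>0$ for all $r$; in particular, at almost every $\omega$. 3. Let $\omega_0\in[-\pi,\pi]$ be such that $S_j$ has no pole at $e^{\hat{j}\omega_0}$ (that is, $\omega_0\ne\pm\pi$ or $a_{m,j}=0$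 for all $m$), and let $\Phi_{p_r}(\omega)/\Phi_{p_j}(\omega)$ have a positive limit as $\omega\to\omega_0$ for every $r$. Then $W_{ji}(e^{\hat{j}\omega})$ has a limit as $\omega\to\omega_0$, and the phase of this limit is $\pi$. 4. If $\mathbf W$ is the frequency response of a linear filter (a limit of finite impulse response filters, with outputs converging in mean square and responses converging in $L^2(\Phi_{X_{\bar j}}\,d\omega)$) whose output minimizes, at every time $k$, the error $\mathbb E(x_j(k)-q)^2$ over $q$ in the closed span of $\{x_r(k'):r\ne j,\ k'\in\mathbb Z\}$, then for almost every $\omega\in[-\pi,\pi]$ one has $\mathbf W(\omega)=W_j(e^{\hat{j}\omega})$ and $\angle \mathbf W_{i}(\omega)=\pi$. -/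

import Mathlib

open MeasureTheory Filter Topology
open scoped ProbabilityTheory ComplexOrder

noncomputable section

namespace NetDyn

/-! ### Second-order processes and power spectral densities -/

section Processes

variable {Ω : Type*} [MeasurableSpace Ω] {ι : Type*}

/-- The family of real processes `x i` is jointly wide sense stationary: square integrable, with
constant means, and with second moments that depend on the time lag only. -/
structure IsJWSS (μ : Measure Ω) (x : ι → ℤ → Ω → ℝ) : Prop where
  memLp : ∀ i k, MemLp (x i k) 2 μ
  mean : ∀ i k, ∫ w, x i k w ∂μ = ∫ w, x i 0 w ∂μ
  corr : ∀ i j k h, ∫ w, x i (k + h) w * x j k w ∂μ = ∫ w, x i h w * x j 0 w ∂μ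

/-- The correlation `E (x_i(k) x_j(0))`. -/
def corr (μ : Measure Ω) (x : ι → ℤ → Ω → ℝ) (i j : ι) (k : ℤ) : ℝ :=
  ∫ w, x i k w * x j 0 w ∂μ

/-- The correlation sequences are absolutely summable, so that the series that defines the power
spectral density converges at every frequency. -/
def HasPSD (μ : Measure Ω) (x : ι → ℤ → Ω → ℝ) : Prop :=
  ∀ i j, Summable fun k : ℤ => |corr μ x i j k|

/-- The power spectral density matrix `Φ_x(ω) = ∑_k E (x(k) x(0)ᵀ) e^{-jωk}`. -/
def psd (μ : Measure Ω) (x : ι → ℤ → Ω → ℝ) (ω : ℝ) : Matrix ι ι ℂ :=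
  Matrix.of fun i j =>
    ∑' k : ℤ, (corr μ x i j k : ℂ) * Complex.exp (-(Complex.I * (ω : ℂ) * (k : ℂ)))

/-- The delay operator `(B u)(k) = u(k - 1)` on processes; it corresponds to `z⁻¹`. -/
def delay (Ω : Type*) : Module.End ℝ (ℤ → Ω → ℝ) where
  toFun u k := u (k - 1)
  map_add' _ _ := rfl
  map_smul' _ _ := rfl

end Processes

/-! ### Networked linear dynamics and its generative graph -/

/-- The coefficients of the dynamics
`∑_{m=1}^{l} a_{m,i} x_i^{(m)} = ∑_{j ≠ i} b_{ij} (x_j - x_i) + p_i` and the sampling time `Δt`.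
Only the values `a m i` with `1 ≤ m ≤ l` and `b i j` with `i ≠ j` are used. -/
structure Network (n : ℕ) where
  l : ℕ
  a : ℕ → Fin n → ℝ
  b : Fin n → Fin n → ℝ
  Δt : ℝ
  Δt_pos : 0 < Δt
  b_nonneg : ∀ i j, i ≠ j → 0 ≤ b i j

namespace Network

variable {n : ℕ} (N : Network n)

/-- `S_i(z) = ∑_{m=1}^{l} a_{m,i} (2 (1 - z⁻¹) / (Δt (1 + z⁻¹)))^m + ∑_{j ≠ i} b_{ij}`. -/
def S (i : Fin n) (z : ℂ) : ℂ :=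
  ∑ m ∈ Finset.Icc 1 N.l,
      (N.a m i : ℂ) * (2 * (1 - z⁻¹) / ((N.Δt : ℂ) * (1 + z⁻¹))) ^ m
    + ∑ j ∈ Finset.univ.erase i, (N.b i j : ℂ)

/-- The transfer functions `H_{ij}(z) = b_{ij} / S_i(z)`, with zero diagonal. -/
def H (i j : Fin n) (z : ℂ) : ℂ :=
  if i = j then 0 else (N.b i j : ℂ) / N.S i z

/-- The edge from `j` to `i` is in the generative graph: `H_{ij} ≠ 0` almost everywhere on the
unit circle. Then `j` is a parent of `i`, and `i` is a child of `j`. -/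
def IsEdge (i j : Fin n) : Prop :=
  ∀ᵐ ω : ℝ ∂(volume.restrict (Set.Icc (-Real.pi) Real.pi)),
    N.H i j (Complex.exp (Complex.I * (ω : ℂ))) ≠ 0

/-- The children of `j`. -/
def children (j : Fin n) : Set (Fin n) := {k | N.IsEdge k j}

/-- The topology: the undirected graph obtained by forgetting the orientation of the edges. -/
def topology : SimpleGraph (Fin n) := SimpleGraph.fromRel N.IsEdge

/-- Distinct nodes that have a common child and are not neighbors in the topology. -/
def StrictSpouses (i j : Fin n) : Prop :=
  i ≠ j ∧ (N.children i ∩ N.children j).Nonempty ∧ ¬ N.topology.Adj i j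

/-- The processes `x` and `p` satisfy the discretization of the dynamics by the bilinear transform
`d/dt ↦ (2 / Δt) (1 - z⁻¹) / (1 + z⁻¹)`, that is `S_i(z) X_i(z) = ∑_{j ≠ i} b_{ij} X_j(z) + P_i(z)`,
written as a difference equation (both sides are multiplied by `(1 + z⁻¹)^l`). -/
def Satisfies {Ω : Type*} [MeasurableSpace Ω] (μ : Measure Ω)
    (x p : Fin n → ℤ → Ω → ℝ) : Prop :=
  ∀ (i : Fin n) (k : ℤ), ∀ᵐ w ∂μ,
    (∑ m ∈ Finset.Icc 1 N.l, (N.a m i * (2 / N.Δt) ^ m) •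
        ((1 - delay Ω) ^ m * (1 + delay Ω) ^ (N.l - m)) (x i)) k w
      = ((1 + delay Ω) ^ N.l)
          (∑ j ∈ Finset.univ.erase i, N.b i j • (x j - x i) + p i) k w

end Network

/-! ### The non-causal multivariate Wiener filter -/

section Wiener

variable {Ω : Type*} [MeasurableSpace Ω] {n : ℕ}

/-- The frequency response `W_j(e^{jω}) = Φ_{x_j X}(ω) Φ_X(ω)⁻¹` of the multivariate Wiener filter
that estimates `x_j` from `X = (x_i)_{i ≠ j}`; the entry `i` is `W_{ji}(e^{jω})`. -/
def wienerFilter (μ : Measure Ω) (x : Fin n → ℤ → Ω → ℝ) (j : Fin n) (ω : ℝ) :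
    {i : Fin n // i ≠ j} → ℂ :=
  Matrix.vecMul (fun i : {i : Fin n // i ≠ j} => psd μ x ω j i.1)
    ((psd μ x ω).submatrix (fun i : {i : Fin n // i ≠ j} => i.1) (fun i => i.1))⁻¹

/-- The element `∑_{i ≠ j} ∑_L h_i(L) x_i(k - L)` of `span {x_i(k) : i ≠ j, k ∈ ℤ}`, produced by
the finite impulse responses `h_i`. -/
def firOutput (x : Fin n → ℤ → Ω → ℝ) {j : Fin n} (h : {i : Fin n // i ≠ j} → ℤ →₀ ℝ)
    (k : ℤ) (w : Ω) : ℝ :=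
  ∑ i, (h i).sum fun L c => c * x i (k - L) w

/-- The frequency response `∑_L h_i(L) e^{-jωL}` of finite impulse responses. -/
def firResponse {j : Fin n} (h : {i : Fin n // i ≠ j} → ℤ →₀ ℝ) (ω : ℝ)
    (i : {i : Fin n // i ≠ j}) : ℂ :=
  (h i).sum fun L c => (c : ℂ) * Complex.exp (-(Complex.I * (ω : ℂ) * (L : ℂ)))

/-- `W` is the frequency response of a linear filter on `(x_i)_{i ≠ j}` whose output `v` solves the
least squares problem `inf {E (x_j(k) - q)² : q ∈ closed span {x_i(k') : i ≠ j, k' ∈ ℤ}}` at every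
time `k`. The filter is a limit of finite impulse response filters: their outputs converge to `v`
in mean square, and their responses converge to `W` in the mean square weighted by the power
spectral density. -/
def IsLeastSquaresResponse (μ : Measure Ω) (x : Fin n → ℤ → Ω → ℝ) (j : Fin n)
    (W : ℝ → {i : Fin n // i ≠ j} → ℂ) : Prop :=
  (∀ i, AEMeasurable (fun ω => W ω i) (volume.restrict (Set.Icc (-Real.pi) Real.pi))) ∧
  ∃ (v : ℤ → Ω → ℝ) (h : ℕ → {i : Fin n // i ≠ j} → ℤ →₀ ℝ),
    (∀ k, MemLp (v k) 2 μ) ∧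
    (∀ k, Tendsto (fun r => ∫ w, (v k w - firOutput x (h r) k w) ^ 2 ∂μ) atTop (𝓝 0)) ∧
    Tendsto (fun r => ∫⁻ ω in Set.Icc (-Real.pi) Real.pi, ENNReal.ofReal
        (∑ a : {i : Fin n // i ≠ j}, ∑ b : {i : Fin n // i ≠ j},
          (W ω a - firResponse (h r) ω a) * psd μ x ω a.1 b.1 *
          star (W ω b - firResponse (h r) ω b)).re) atTop (𝓝 0) ∧
    ∀ (k : ℤ) (g : {i : Fin n // i ≠ j} → ℤ →₀ ℝ),
      ∫ w, (x j k w - v k w) ^ 2 ∂μ ≤ ∫ w, (x j k w - firOutput x g k w) ^ 2 ∂μ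

end Wiener

end NetDyn

end

/-! Let `M` have diagonal entries `S_i` and off-diagonal entries `-b_{ik}`, and let `D` be the
diagonal matrix of the forcing densities `d_r`. Off `z = -1`, correlating the difference equation
with itself and cancelling `|1 + z⁻¹|^(2l)` gives `M Φ_x Mᴴ = D` (`dynMatrix_mul_psd_mul`,
`psd_eq_diagonal`). Where `D` is positive, `M` is therefore invertible, `Φ_x` is positive definite
and `K = Φ_x⁻¹` equals `Mᴴ D⁻¹ M`. No `S_i` is ever inverted, so zeros of `S_i` do no harm.

The normal equations give `W_{ji} = -K_{ji} / K_{jj}` (`wienerFilter_eq_inv`). For strict spouses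
`M_{ij} = M_{ji} = 0`, so `S_i` and `S_j` drop out of `K_{ji} = ∑_{r ≠ i,j} b_{rj} b_{ri} / d_r`.
This is positive because of the common child, and `K_{jj} > 0`, so `W_{ji}` is a negative real
number.

Exceptional frequencies are reached by limits. Where `Φ_x` is positive definite, `K` is continuous,
and the bound `b_{rj} b_{ri} ≤ K_{ji} d_r` keeps the limit of `K_{ji}` away from zero. Where `Φ_x`
may be singular, multiplying `K_{ji}` and `K_{jj}` by `d_j` leaves only the ratios `d_j / d_r` and
`|S_j|²`, which converge.

For the least squares filter, minimality makes the error orthogonal to every `x_i(k')`. Along the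
approximating FIR filters, the cross spectra of the error with `x_i` then have Fourier coefficients
tending to zero, while by Cauchy-Schwarz they converge in `L²` to the defect of the normal
equations. By Parseval the defect vanishes almost everywhere. -/

namespace NetDyn

/-! ### Cross spectral densities and the action of delay operators on them. -/

section CrossSpectra

variable {Ω : Type*} [MeasurableSpace Ω] {μ : Measure Ω}

/-- Two square integrable processes with stationary and summable cross-correlation. -/
structure CrossStat (μ : Measure Ω) (f g : ℤ → Ω → ℝ) : Prop where
  memLp_left : ∀ k, MemLp (f k) 2 μ
  memLp_right : ∀ k, MemLp (g k) 2 μ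
  corr : ∀ k h, ∫ w, f (k + h) w * g k w ∂μ = ∫ w, f h w * g 0 w ∂μ
  summable : Summable fun k : ℤ => |∫ w, f k w * g 0 w ∂μ|

/-- The cross spectral density of two processes. -/
noncomputable def cs (μ : Measure Ω) (f g : ℤ → Ω → ℝ) (ω : ℝ) : ℂ :=
  ∑' k : ℤ, ((∫ w, f k w * g 0 w ∂μ : ℝ) : ℂ) * Complex.exp (-(Complex.I * (ω : ℂ) * (k : ℂ)))

theorem psd_eq_cs {ι : Type*} (x : ι → ℤ → Ω → ℝ) (ω : ℝ) (i j : ι) :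
    psd μ x ω i j = cs μ (x i) (x j) ω := rfl

theorem IsJWSS.crossStat {ι : Type*} {x : ι → ℤ → Ω → ℝ} (hx : IsJWSS μ x) (hs : HasPSD μ x)
    (i j : ι) : CrossStat μ (x i) (x j) :=
  ⟨hx.memLp i, hx.memLp j, hx.corr i j, hs i j⟩

theorem norm_exp_freq (ω : ℝ) (k : ℤ) :
    ‖Complex.exp (-(Complex.I * (ω : ℂ) * (k : ℂ)))‖ = 1 := by
  have : -(Complex.I * (ω : ℂ) * (k : ℂ)) = ((-(ω * k) : ℝ) : ℂ) * Complex.I := by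
    push_cast; ring
  rw [this, Complex.norm_exp_ofReal_mul_I]

namespace CrossStat

variable {f g f' : ℤ → Ω → ℝ}

theorem integrable (h : CrossStat μ f g) (k m : ℤ) : Integrable (fun w => f k w * g m w) μ :=
  (h.memLp_left k).integrable_mul (h.memLp_right m)

theorem summable_terms (h : CrossStat μ f g) (ω : ℝ) :
    Summable fun k : ℤ => ((∫ w, f k w * g 0 w ∂μ : ℝ) : ℂ) *
      Complex.exp (-(Complex.I * (ω : ℂ) * (k : ℂ))) := by
  refine Summable.of_norm ?_
  simpa [norm_mul, norm_exp_freq] using h.summable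

/-- By stationarity, exchanging the processes reverses the lag. -/
theorem symm (h : CrossStat μ f g) : CrossStat μ g f := by
  have key : ∀ k m, ∫ w, g (k + m) w * f k w ∂μ = ∫ w, f (-m) w * g 0 w ∂μ := by
    intro k m
    have := h.corr (k + m) (-m)
    simp only [add_neg_cancel_right] at this
    rw [← this]
    simp only [mul_comm]
  have key0 : ∀ m, ∫ w, g m w * f 0 w ∂μ = ∫ w, f (-m) w * g 0 w ∂μ := by
    intro m; simpa using key 0 m
  refine ⟨h.memLp_right, h.memLp_left, fun k m => by rw [key, key0], ?_⟩
  simp only [key0]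
  exact (Equiv.neg ℤ).summable_iff.2 h.summable

theorem cs_symm (h : CrossStat μ f g) (ω : ℝ) : cs μ g f ω = star (cs μ f g ω) := by
  have key0 : ∀ m, ∫ w, g m w * f 0 w ∂μ = ∫ w, f (-m) w * g 0 w ∂μ := by
    intro m
    have := h.corr m (-m)
    simp only [add_neg_cancel] at this
    rw [← this]
    simp only [mul_comm]
  unfold cs
  rw [tsum_star, ← (Equiv.neg ℤ).tsum_eq]
  refine tsum_congr fun k => ?_
  simp only [Equiv.neg_apply, key0, neg_neg, Int.cast_neg, star_mul', Complex.star_def,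
    Complex.conj_ofReal, ← Complex.exp_conj]
  congr 2
  simp

theorem add (h : CrossStat μ f g) (h' : CrossStat μ f' g) :
    CrossStat μ (f + f') g ∧ ∀ ω, cs μ (f + f') g ω = cs μ f g ω + cs μ f' g ω := by
  have key : ∀ k m, ∫ w, (f + f') k w * g m w ∂μ
      = ∫ w, f k w * g m w ∂μ + ∫ w, f' k w * g m w ∂μ := by
    intro k m
    rw [← integral_add (h.integrable k m) (h'.integrable k m)]
    simp only [Pi.add_apply, add_mul]
  refine ⟨⟨fun k => (h.memLp_left k).add (h'.memLp_left k), h.memLp_right, fun k m => ?_, ?_⟩, ?_⟩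
  · rw [key, key, h.corr, h'.corr]
  · simp only [key]
    exact Summable.of_nonneg_of_le (fun _ => abs_nonneg _) (fun _ => abs_add_le _ _)
      (h.summable.add h'.summable)
  · intro ω
    unfold cs
    rw [← (h.summable_terms ω).tsum_add (h'.summable_terms ω)]
    simp only [key, Complex.ofReal_add, add_mul]

theorem smul (c : ℝ) (h : CrossStat μ f g) :
    CrossStat μ (c • f) g ∧ ∀ ω, cs μ (c • f) g ω = c * cs μ f g ω := by
  have key : ∀ k m, ∫ w, (c • f) k w * g m w ∂μ = c * ∫ w, f k w * g m w ∂μ := by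
    intro k m
    rw [← integral_const_mul]
    simp only [Pi.smul_apply, smul_eq_mul, mul_assoc]
  refine ⟨⟨fun k => (h.memLp_left k).const_smul c, h.memLp_right, fun k m => ?_, ?_⟩, ?_⟩
  · rw [key, key, h.corr]
  · simp only [key, abs_mul]
    exact h.summable.mul_left _
  · intro ω
    unfold cs
    simp only [key, Complex.ofReal_mul, mul_assoc, tsum_mul_left]

theorem neg (h : CrossStat μ f g) :
    CrossStat μ (-f) g ∧ ∀ ω, cs μ (-f) g ω = -cs μ f g ω := by
  simpa using h.smul (-1)

theorem sub (h : CrossStat μ f g) (h' : CrossStat μ f' g) :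
    CrossStat μ (f - f') g ∧ ∀ ω, cs μ (f - f') g ω = cs μ f g ω - cs μ f' g ω := by
  rw [sub_eq_add_neg]
  refine ⟨(h.add h'.neg.1).1, fun ω => ?_⟩
  rw [(h.add h'.neg.1).2, h'.neg.2, sub_eq_add_neg]

theorem zero (hg : ∀ k, MemLp (g k) 2 μ) :
    CrossStat μ 0 g ∧ ∀ ω, cs μ 0 g ω = 0 := by
  refine ⟨⟨fun k => MemLp.zero', hg, fun k m => ?_, ?_⟩, fun ω => ?_⟩
  · simp
  · simp
  · simp [cs]

theorem sum {ι : Type*} (s : Finset ι) {F : ι → ℤ → Ω → ℝ} (hg : ∀ k, MemLp (g k) 2 μ)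
    (h : ∀ i ∈ s, CrossStat μ (F i) g) :
    CrossStat μ (∑ i ∈ s, F i) g ∧ ∀ ω, cs μ (∑ i ∈ s, F i) g ω = ∑ i ∈ s, cs μ (F i) g ω := by
  classical
  induction s using Finset.induction_on with
  | empty => simpa using zero hg
  | insert a s ha ih =>
    have ih' := ih fun i hi => h i (Finset.mem_insert_of_mem hi)
    have h1 := (h a (Finset.mem_insert_self _ _)).add ih'.1
    simp only [Finset.sum_insert ha]
    exact ⟨h1.1, fun ω => by rw [h1.2, ih'.2]⟩

/-- The process shifted by `L` steps. -/
theorem shift (h : CrossStat μ f g) (L : ℤ) :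
    CrossStat μ (fun k => f (k - L)) g ∧ ∀ ω, cs μ (fun k => f (k - L)) g ω
      = Complex.exp (-(Complex.I * (ω : ℂ) * (L : ℂ))) * cs μ f g ω := by
  refine ⟨⟨fun k => h.memLp_left _, h.memLp_right, fun k m => ?_, ?_⟩, fun ω => ?_⟩
  · simp only [add_sub_assoc]
    rw [h.corr]
  · exact (Equiv.subRight L).summable_iff.2 h.summable
  · unfold cs
    rw [← tsum_mul_left, ← (Equiv.addRight L).tsum_eq]
    refine tsum_congr fun k => ?_
    simp only [Equiv.coe_addRight, add_sub_cancel_right]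
    rw [mul_left_comm, ← Complex.exp_add]
    congr 2
    push_cast; ring

theorem congr_ae {g' : ℤ → Ω → ℝ} (hf : ∀ k, f k =ᵐ[μ] f' k) (hg : ∀ k, g k =ᵐ[μ] g' k) (ω : ℝ) :
    cs μ f g ω = cs μ f' g' ω := by
  unfold cs
  refine tsum_congr fun k => ?_
  congr 2
  refine integral_congr_ae ?_
  filter_upwards [hf k, hg 0] with w h1 h2
  rw [h1, h2]

theorem continuous_cs (h : CrossStat μ f g) : Continuous (cs μ f g) := by
  unfold cs
  refine continuous_tsum (u := fun k : ℤ => |∫ w, f k w * g 0 w ∂μ|) (fun k => by fun_prop)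
    h.summable fun k ω => ?_
  simp [norm_exp_freq]

/-- Absolute summability allows termwise integration, and orthogonality of the exponentials leaves
the term at lag `k`. This carries information from correlations back to spectra. -/
theorem integral_cs_mul_exp (h : CrossStat μ f g) (k : ℤ) :
    ∫ ω in Set.Icc (-Real.pi) Real.pi, cs μ f g ω * Complex.exp (Complex.I * (ω : ℂ) * (k : ℂ))
      = 2 * Real.pi * ((∫ w, f k w * g 0 w ∂μ : ℝ) : ℂ) := by
  have horth : ∀ m : ℤ, ∫ ω in Set.Icc (-Real.pi) Real.pi,
      Complex.exp (-(Complex.I * (ω : ℂ) * (m : ℂ))) * Complex.exp (Complex.I * (ω : ℂ) * (k : ℂ))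
      = if m = k then 2 * (Real.pi : ℂ) else 0 := by
    intro m
    rw [integral_Icc_eq_integral_Ioc, ← intervalIntegral.integral_of_le (by linarith [Real.pi_pos])]
    have : ∀ ω : ℝ, Complex.exp (-(Complex.I * (ω : ℂ) * (m : ℂ))) *
        Complex.exp (Complex.I * (ω : ℂ) * (k : ℂ)) = Complex.exp ((Complex.I * (k - m)) * ω) := by
      intro ω; rw [← Complex.exp_add]; congr 1; ring
    simp only [this]
    split_ifs with hmk
    · subst hmk; simp; ring
    · have h0 : (Complex.I * ((k : ℂ) - m)) ≠ 0 :=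
        mul_ne_zero Complex.I_ne_zero (sub_ne_zero.2 fun h => hmk (by exact_mod_cast h.symm))
      rw [integral_exp_mul_complex h0, div_eq_zero_iff]
      left
      rw [sub_eq_zero, Complex.exp_eq_exp_iff_exists_int]
      exact ⟨k - m, by push_cast; ring⟩
  unfold cs
  simp only [← tsum_mul_right]
  rw [← integral_tsum_of_summable_integral_norm]
  · have hterm : ∀ m : ℤ, ∫ ω in Set.Icc (-Real.pi) Real.pi,
        ((∫ w, f m w * g 0 w ∂μ : ℝ) : ℂ) * Complex.exp (-(Complex.I * (ω : ℂ) * (m : ℂ))) *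
          Complex.exp (Complex.I * (ω : ℂ) * (k : ℂ))
        = ((∫ w, f m w * g 0 w ∂μ : ℝ) : ℂ) * if m = k then 2 * (Real.pi : ℂ) else 0 := by
      intro m
      rw [← horth, ← integral_const_mul]
      simp only [mul_assoc]
    simp only [hterm]
    rw [tsum_eq_single k fun m hm => by rw [if_neg hm, mul_zero], if_pos rfl, mul_comm]
  · intro m
    refine Continuous.integrableOn_Icc (by fun_prop)
  · have hn : ∀ ω : ℝ, ‖Complex.exp (Complex.I * (ω : ℂ) * (k : ℂ))‖ = 1 := fun ω => by
      simpa using norm_exp_freq ω (-k)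
    simp only [norm_mul, norm_exp_freq, hn, mul_one, setIntegral_const, smul_eq_mul,
      Complex.norm_real, Real.norm_eq_abs]
    exact h.summable.mul_left _

end CrossStat

/-- Punctured neighborhoods of `±π` leave `[-π, π]`; periodicity transports the sign of the forcing
densities there. -/
theorem cs_periodic (f g : ℤ → Ω → ℝ) : Function.Periodic (cs μ f g) (2 * Real.pi) := by
  intro ω
  unfold cs
  refine tsum_congr fun k => ?_
  congr 1
  rw [Complex.exp_eq_exp_iff_exists_int]
  exact ⟨-k, by push_cast; ring⟩

/-- The operator `T` acts on cross spectral densities as multiplication by `c`. -/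
def HasResponse (μ : Measure Ω) (T : Module.End ℝ (ℤ → Ω → ℝ)) (ω : ℝ) (c : ℂ) : Prop :=
  ∀ f g, CrossStat μ f g → CrossStat μ (T f) g ∧ cs μ (T f) g ω = c * cs μ f g ω

namespace HasResponse

variable {S T : Module.End ℝ (ℤ → Ω → ℝ)} {ω : ℝ} {c d : ℂ}

theorem delay : HasResponse μ (delay Ω) ω (Complex.exp (-(Complex.I * (ω : ℂ)))) := by
  intro f g h
  have := h.shift 1
  refine ⟨this.1, (this.2 ω).trans ?_⟩
  simp

theorem one : HasResponse μ (1 : Module.End ℝ (ℤ → Ω → ℝ)) ω 1 := fun f g h => ⟨h, by simp⟩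

theorem mul (hS : HasResponse μ S ω c) (hT : HasResponse μ T ω d) :
    HasResponse μ (S * T) ω (c * d) := by
  intro f g h
  have h1 := hT f g h
  have h2 := hS _ g h1.1
  exact ⟨h2.1, by rw [mul_assoc, ← h1.2, ← h2.2]; rfl⟩

theorem pow (hS : HasResponse μ S ω c) (m : ℕ) : HasResponse μ (S ^ m) ω (c ^ m) := by
  induction m with
  | zero => simpa using one
  | succ m ih => simpa only [pow_succ] using ih.mul hS

theorem add (hS : HasResponse μ S ω c) (hT : HasResponse μ T ω d) :
    HasResponse μ (S + T) ω (c + d) := by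
  intro f g h
  have := (hS f g h).1.add (hT f g h).1
  exact ⟨this.1, by rw [add_mul, ← (hS f g h).2, ← (hT f g h).2, ← this.2]; rfl⟩

theorem sub (hS : HasResponse μ S ω c) (hT : HasResponse μ T ω d) :
    HasResponse μ (S - T) ω (c - d) := by
  intro f g h
  have := (hS f g h).1.sub (hT f g h).1
  exact ⟨this.1, by rw [sub_mul, ← (hS f g h).2, ← (hT f g h).2, ← this.2]; rfl⟩

end HasResponse

end CrossSpectra

/-! ### Congruence to a diagonal matrix. -/

section LinearAlgebra

open Matrix

variable {m : Type*} [Fintype m] [DecidableEq m]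

/-- Congruence to a positive diagonal matrix yields positive definiteness and the inverse. -/
theorem posDef_and_inv_of_congr_diagonal {M Φ : Matrix m m ℂ} {d : m → ℝ} (hd : ∀ r, 0 < d r)
    (h : M * Φ * Mᴴ = diagonal fun r => (d r : ℂ)) :
    Φ.PosDef ∧ ∀ a b, Φ⁻¹ a b = ∑ r, star (M r a) * (d r : ℂ)⁻¹ * M r b := by
  have hD : (diagonal fun r => (d r : ℂ)).PosDef :=
    PosDef.diagonal fun r => by exact_mod_cast hd r
  -- Invertibility of `M` comes for free: its determinant divides that of the positive diagonal
  -- matrix.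
  have hdet := (Matrix.isUnit_iff_isUnit_det _).1 hD.isUnit
  rw [← h, det_mul, det_mul] at hdet
  have hM : IsUnit M.det := isUnit_of_mul_isUnit_left (isUnit_of_mul_isUnit_left hdet)
  have hMH : IsUnit Mᴴ.det := isUnit_of_mul_isUnit_right hdet
  have hΦ : Φ = M⁻¹ * (diagonal fun r => (d r : ℂ)) * (M⁻¹)ᴴ := by
    rw [← h, conjTranspose_nonsing_inv, mul_assoc, mul_nonsing_inv_cancel_right _ _ hMH,
      nonsing_inv_mul_cancel_left _ _ hM]
  refine ⟨?_, ?_⟩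
  · rw [hΦ]
    refine hD.mul_mul_conjTranspose_same ?_
    refine Function.LeftInverse.injective (g := fun v => v ᵥ* M) fun v => ?_
    simp [vecMul_vecMul, nonsing_inv_mul _ hM]
  · have hinv : Φ⁻¹ = Mᴴ * (diagonal fun r => (d r : ℂ)⁻¹) * M := by
      refine inv_eq_left_inv ?_
      have h1 : (diagonal fun r => (d r : ℂ)⁻¹) * (diagonal fun r => (d r : ℂ)) = 1 := by
        rw [diagonal_mul_diagonal, ← diagonal_one]
        congr 1
        ext r
        exact inv_mul_cancel₀ (by exact_mod_cast (hd r).ne')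
      rw [hΦ, conjTranspose_nonsing_inv]
      calc _ = Mᴴ * (diagonal fun r => (d r : ℂ)⁻¹) * (M * M⁻¹) *
            (diagonal fun r => (d r : ℂ)) * Mᴴ⁻¹ := by simp only [mul_assoc]
        _ = Mᴴ * ((diagonal fun r => (d r : ℂ)⁻¹) * (diagonal fun r => (d r : ℂ))) * Mᴴ⁻¹ := by
            rw [mul_nonsing_inv _ hM, mul_one, mul_assoc Mᴴ]
        _ = 1 := by rw [h1, mul_one, mul_nonsing_inv _ hMH]
    intro a b
    rw [hinv, mul_apply]
    simp [mul_diagonal]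

end LinearAlgebra

/-! ### Normal equations and the Wiener filter. -/

section WienerAlgebra

open Matrix

variable {Ω : Type*} [MeasurableSpace Ω] {μ : Measure Ω} {n : ℕ} {x : Fin n → ℤ → Ω → ℝ}

/-- The normal equations determine the Wiener filter. -/
theorem eq_wienerFilter {ω : ℝ} (hΦ : (psd μ x ω).PosDef) {j : Fin n}
    {w : {i : Fin n // i ≠ j} → ℂ}
    (hw : ∀ i : {i : Fin n // i ≠ j}, psd μ x ω j i.1 = ∑ a, w a * psd μ x ω a.1 i.1) :
    w = wienerFilter μ x j ω := by
  have hu := (Matrix.isUnit_iff_isUnit_det _).1 (hΦ.submatrix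
    (e := fun i : {i : Fin n // i ≠ j} => i.1) Subtype.val_injective).isUnit
  unfold wienerFilter
  have : (fun i : {i : Fin n // i ≠ j} => psd μ x ω j i.1)
      = w ᵥ* (psd μ x ω).submatrix (fun i : {i : Fin n // i ≠ j} => i.1) (fun i => i.1) := by
    ext i
    rw [hw i]
    rfl
  rw [this, vecMul_vecMul, mul_nonsing_inv _ hu, vecMul_one]

theorem sum_eq_add_sum_ne {α : Type*} [AddCommMonoid α] (j : Fin n) (f : Fin n → α) :
    ∑ a, f a = f j + ∑ a : {i : Fin n // i ≠ j}, f a.1 := by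
  rw [← Finset.add_sum_erase _ _ (Finset.mem_univ j)]
  congr 1
  exact Finset.sum_subtype _ (by simp) _

/-- The Wiener filter in terms of the inverse of the power spectral density. -/
theorem wienerFilter_eq_inv {ω : ℝ} (hΦ : (psd μ x ω).PosDef) {j : Fin n}
    (i : {i : Fin n // i ≠ j}) :
    wienerFilter μ x j ω i = -((psd μ x ω)⁻¹ j i.1 / (psd μ x ω)⁻¹ j j) := by
  have hu := (Matrix.isUnit_iff_isUnit_det _).1 hΦ.isUnit
  have hjj : (psd μ x ω)⁻¹ j j ≠ 0 := (hΦ.inv.diag_pos (i := j)).ne'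
  rw [← eq_wienerFilter hΦ (w := fun i => -((psd μ x ω)⁻¹ j i.1 / (psd μ x ω)⁻¹ j j))]
  intro b
  -- Off the diagonal, row `j` of `Φ⁻¹ Φ = 1` is the system of normal equations, up to division by
  -- `-(Φ⁻¹)_{jj}`.
  have h := congrFun (congrFun (nonsing_inv_mul _ hu) j) b.1
  rw [mul_apply, one_apply_ne b.2.symm, sum_eq_add_sum_ne j] at h
  have h2 : ∑ a : {i : Fin n // i ≠ j}, -((psd μ x ω)⁻¹ j a.1 / (psd μ x ω)⁻¹ j j) *
      psd μ x ω a.1 b.1 = -((psd μ x ω)⁻¹ j j)⁻¹ *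
        ∑ a : {i : Fin n // i ≠ j}, (psd μ x ω)⁻¹ j a.1 * psd μ x ω a.1 b.1 := by
    rw [Finset.mul_sum]
    exact Finset.sum_congr rfl fun a _ => by ring
  rw [h2, eq_neg_of_add_eq_zero_right h]
  field_simp

/-- Cauchy-Schwarz inequality for a positive definite matrix. -/
theorem norm_sq_sum_mul_le {m : Type*} [Fintype m] [DecidableEq m] {A : Matrix m m ℂ}
    (hA : A.PosDef) (e : m → ℂ) (i : m) :
    ‖∑ a, e a * A a i‖ ^ 2 ≤ (A i i).re * (∑ a, ∑ b, e a * A a b * star (e b)).re := by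
  set s := ∑ a, e a * A a i with hs
  have hH : ∀ a b, star (A a b) = A b a := fun a b => hA.1.apply b a
  have hii : 0 < (A i i).re := (Complex.pos_iff.1 hA.diag_pos).1
  have hii' : A i i = ((A i i).re : ℂ) := by
    apply Complex.ext <;> simp [← (Complex.pos_iff.1 (hA.diag_pos (i := i))).2]
  have hs' : ∑ b, A i b * star (e b) = star s := by
    rw [hs, star_sum]
    exact Finset.sum_congr rfl fun b _ => by rw [star_mul', hH, mul_comm]
  set t : ℂ := s / (A i i).re with ht
  have hpos := hA.posSemidef.dotProduct_mulVec_nonneg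
    (fun b => star (e b - t * if b = i then 1 else 0))
  have hexp : star (fun b => star (e b - t * if b = i then 1 else 0)) ⬝ᵥ
      A *ᵥ (fun b => star (e b - t * if b = i then 1 else 0))
      = (∑ a, ∑ b, e a * A a b * star (e b)) - ((‖s‖ ^ 2 / (A i i).re : ℝ) : ℂ) := by
    have h1 : star (fun b => star (e b - t * if b = i then 1 else 0)) ⬝ᵥ
      A *ᵥ (fun b => star (e b - t * if b = i then 1 else 0))
      = (∑ a, e a * ∑ b, A a b * star (e b)) - star t * s - t * star s + t * star t * A i i := by
      simp only [dotProduct, mulVec, Pi.star_apply, star_star, star_sub, star_mul', mul_sub, sub_mul,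
        Finset.sum_sub_distrib]
      simp only [apply_ite star, star_one, star_zero, mul_ite, mul_one, mul_zero, ite_mul, zero_mul,
        Finset.sum_ite_eq', Finset.mem_univ, if_true, hs']
      have : ∑ a, e a * (A a i * star t) = star t * s := by
        rw [hs, Finset.mul_sum]; exact Finset.sum_congr rfl fun a _ => by ring
      rw [this]; ring
    have hne : ((A i i).re : ℂ) ≠ 0 := by exact_mod_cast hii.ne'
    have hss : s * star s = ((‖s‖ ^ 2 : ℝ) : ℂ) := by
      rw [Complex.star_def, Complex.mul_conj, Complex.normSq_eq_norm_sq]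
    have hst : star t = star s / (A i i).re := by
      rw [ht, star_div₀]; simp
    rw [h1, hst, ht, hii']
    simp only [Complex.ofReal_re, Complex.ofReal_div]
    rw [← hss]
    simp only [Finset.mul_sum, mul_assoc]
    field_simp
    ring
  rw [hexp] at hpos
  have := (Complex.nonneg_iff.1 hpos).1
  rw [Complex.sub_re, Complex.ofReal_re, sub_nonneg, div_le_iff₀ hii] at this
  linarith

end WienerAlgebra

/-! ### The dynamics in the frequency domain. -/

section Dynamics

open Matrix

variable {Ω : Type*} [MeasurableSpace Ω] {μ : Measure Ω} {n : ℕ}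

namespace Network

variable (N : Network n)

/-- The matrix of the dynamics in the frequency domain. -/
noncomputable def dynMatrix (ω : ℝ) : Matrix (Fin n) (Fin n) ℂ :=
  Matrix.of fun i k =>
    if i = k then N.S i (Complex.exp (Complex.I * (ω : ℂ))) else -(N.b i k : ℂ)

/-- The numerator of the part of `S_i` that comes from the derivatives. -/
noncomputable def numer (i : Fin n) (u : ℂ) : ℂ :=
  ∑ m ∈ Finset.Icc 1 N.l, ((N.a m i * (2 / N.Δt) ^ m : ℝ) : ℂ) * ((1 - u) ^ m * (1 + u) ^ (N.l - m))

/-- Clearing denominators turns `S_i` into the symbol of the difference equation, a polynomial in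
`z⁻¹`. -/
theorem pow_mul_S {z : ℂ} (hz : 1 + z⁻¹ ≠ 0) (i : Fin n) :
    (1 + z⁻¹) ^ N.l * N.S i z
      = N.numer i z⁻¹ + (1 + z⁻¹) ^ N.l * ∑ j ∈ Finset.univ.erase i, (N.b i j : ℂ) := by
  have hΔ : (N.Δt : ℂ) ≠ 0 := by exact_mod_cast N.Δt_pos.ne'
  unfold S numer
  rw [mul_add, Finset.mul_sum]
  congr 1
  refine Finset.sum_congr rfl fun m hm => ?_
  have hml : N.l = m + (N.l - m) := by have := (Finset.mem_Icc.1 hm).2; omega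
  generalize N.l - m = r at *
  rw [hml]
  push_cast
  rw [div_pow, mul_pow, mul_pow, div_pow, pow_add]
  field_simp

/-- The operator `∑_m a_{m,i} (2/Δt)^m (1 - B)^m (1 + B)^{l-m}`. -/
noncomputable def numerOp (Ω : Type*) (i : Fin n) : Module.End ℝ (ℤ → Ω → ℝ) :=
  ∑ m ∈ Finset.Icc 1 N.l, (N.a m i * (2 / N.Δt) ^ m) •
    ((1 - delay Ω) ^ m * (1 + delay Ω) ^ (N.l - m))

theorem hasResponse_one_add_delay (ω : ℝ) (l : ℕ) :
    HasResponse μ ((1 + delay Ω) ^ l) ω ((1 + Complex.exp (-(Complex.I * (ω : ℂ)))) ^ l) :=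
  (HasResponse.one.add HasResponse.delay).pow l

theorem numerOp_response {f g : ℤ → Ω → ℝ} (h : CrossStat μ f g) (i : Fin n) (ω : ℝ) :
    CrossStat μ (N.numerOp Ω i f) g ∧ cs μ (N.numerOp Ω i f) g ω
      = N.numer i (Complex.exp (-(Complex.I * (ω : ℂ)))) * cs μ f g ω := by
  have hm : ∀ m, HasResponse μ ((1 - delay Ω) ^ m * (1 + delay Ω) ^ (N.l - m)) ω
      ((1 - Complex.exp (-(Complex.I * (ω : ℂ)))) ^ m *
        (1 + Complex.exp (-(Complex.I * (ω : ℂ)))) ^ (N.l - m)) := fun m =>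
    ((HasResponse.one.sub HasResponse.delay).pow m).mul (hasResponse_one_add_delay ω _)
  have hsum := CrossStat.sum (Finset.Icc 1 N.l) (g := g) h.memLp_right
    (F := fun m => (N.a m i * (2 / N.Δt) ^ m) •
      ((1 - delay Ω) ^ m * (1 + delay Ω) ^ (N.l - m)) f)
    fun m _ => ((hm m f g h).1.smul _).1
  have heq : N.numerOp Ω i f = ∑ m ∈ Finset.Icc 1 N.l, (N.a m i * (2 / N.Δt) ^ m) •
      ((1 - delay Ω) ^ m * (1 + delay Ω) ^ (N.l - m)) f := by
    unfold numerOp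
    rw [LinearMap.sum_apply]
    rfl
  rw [heq]
  refine ⟨hsum.1, ?_⟩
  rw [hsum.2, numer, Finset.sum_mul]
  refine Finset.sum_congr rfl fun m _ => ?_
  rw [((hm m f g h).1.smul _).2, (hm m f g h).2]
  ring

/-- The process obtained by moving all states in the difference equation to one side. -/
noncomputable def residual (x : Fin n → ℤ → Ω → ℝ) (i : Fin n) : ℤ → Ω → ℝ :=
  N.numerOp Ω i (x i) -
    ((1 + delay Ω) ^ N.l) (∑ j ∈ Finset.univ.erase i, N.b i j • (x j - x i))

theorem residual_ae {x p : Fin n → ℤ → Ω → ℝ} (h : N.Satisfies μ x p) (i : Fin n) (k : ℤ) :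
    N.residual x i k =ᵐ[μ] ((1 + delay Ω) ^ N.l) (p i) k := by
  filter_upwards [h i k] with w hw
  have hsum : (N.numerOp Ω i (x i)) = (∑ m ∈ Finset.Icc 1 N.l, (N.a m i * (2 / N.Δt) ^ m) •
        ((1 - delay Ω) ^ m * (1 + delay Ω) ^ (N.l - m)) (x i)) := by
    rw [numerOp, LinearMap.sum_apply]
    rfl
  rw [residual, hsum, Pi.sub_apply, Pi.sub_apply, hw, map_add, Pi.add_apply, Pi.add_apply]
  ring

/-- The second process stays arbitrary so that the same formula serves both sides of the congruence:
first with a state as `g`, then, through Hermitian symmetry, with another residual. -/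
theorem residual_response {x : Fin n → ℤ → Ω → ℝ} {g : ℤ → Ω → ℝ}
    (h : ∀ i, CrossStat μ (x i) g) (i : Fin n) {ω : ℝ}
    (hω : 1 + Complex.exp (-(Complex.I * (ω : ℂ))) ≠ 0) :
    CrossStat μ (N.residual x i) g ∧ cs μ (N.residual x i) g ω
      = (1 + Complex.exp (-(Complex.I * (ω : ℂ)))) ^ N.l *
        ∑ k, N.dynMatrix ω i k * cs μ (x k) g ω := by
  have h1 := N.numerOp_response (h i) i ω
  have hterm : ∀ j, CrossStat μ (N.b i j • (x j - x i)) g ∧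
      cs μ (N.b i j • (x j - x i)) g ω = N.b i j * (cs μ (x j) g ω - cs μ (x i) g ω) := fun j =>
    ⟨(((h j).sub (h i)).1.smul _).1, by rw [(((h j).sub (h i)).1.smul _).2, ((h j).sub (h i)).2]⟩
  have h2 := CrossStat.sum (Finset.univ.erase i) (h i).memLp_right
    (F := fun j => N.b i j • (x j - x i)) fun j _ => (hterm j).1
  have h3 := hasResponse_one_add_delay (μ := μ) ω N.l _ _ h2.1
  refine ⟨(h1.1.sub h3.1).1, ?_⟩
  have hz : (Complex.exp (Complex.I * (ω : ℂ)))⁻¹ = Complex.exp (-(Complex.I * (ω : ℂ))) := by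
    rw [Complex.exp_neg]
  have hS := N.pow_mul_S (z := Complex.exp (Complex.I * (ω : ℂ))) (by rwa [hz]) i
  rw [hz] at hS
  rw [residual, (h1.1.sub h3.1).2, h1.2, h3.2, h2.2]
  simp only [hterm]
  rw [← Finset.add_sum_erase _ _ (Finset.mem_univ i), mul_add]
  have hoff : ∑ k ∈ Finset.univ.erase i, N.dynMatrix ω i k * cs μ (x k) g ω
      = -∑ k ∈ Finset.univ.erase i, (N.b i k : ℂ) * cs μ (x k) g ω := by
    rw [← Finset.sum_neg_distrib]
    refine Finset.sum_congr rfl fun k hk => ?_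
    rw [dynMatrix, of_apply, if_neg (Finset.ne_of_mem_erase hk).symm, neg_mul]
  have hdiag : N.dynMatrix ω i i = N.S i (Complex.exp (Complex.I * (ω : ℂ))) := by
    rw [dynMatrix, of_apply, if_pos rfl]
  rw [hoff, hdiag, ← mul_assoc, hS]
  simp only [mul_sub, Finset.sum_sub_distrib, ← Finset.sum_mul]
  ring

/-- Away from `z = -1`, the power spectral densities are related by `M Φ_x Mᴴ = Φ_p`. -/
theorem dynMatrix_mul_psd_mul {x p : Fin n → ℤ → Ω → ℝ}
    (hp : IsJWSS μ p) (hp_psd : HasPSD μ p) (hx : IsJWSS μ x) (hx_psd : HasPSD μ x)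
    (hdyn : N.Satisfies μ x p) {ω : ℝ} (hω : 1 + Complex.exp (-(Complex.I * (ω : ℂ))) ≠ 0) :
    N.dynMatrix ω * psd μ x ω * (N.dynMatrix ω)ᴴ = psd μ p ω := by
  have hxx := hx.crossStat hx_psd
  have hpp := hp.crossStat hp_psd
  ext i j
  set q := (1 + Complex.exp (-(Complex.I * (ω : ℂ)))) ^ N.l with hq
  have hq0 : q ≠ 0 := pow_ne_zero _ hω
  have hzx : ∀ i k, CrossStat μ (N.residual x i) (x k) := fun i k =>
    (N.residual_response (fun l => hxx l k) i hω).1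
  have h1 : cs μ (N.residual x i) (N.residual x j) ω = q * star q *
      (N.dynMatrix ω * psd μ x ω * (N.dynMatrix ω)ᴴ) i j := by
    rw [(N.residual_response (fun k => (hzx j k).symm) i hω).2, mul_assoc q]
    congr 1
    simp only [fun k => (hzx j k).cs_symm ω,
      fun k => (N.residual_response (fun l => hxx l k) j hω).2]
    rw [mul_apply, Finset.mul_sum]
    simp only [star_mul', star_sum, ← hq, mul_apply, Finset.mul_sum, Finset.sum_mul,
      conjTranspose_apply, psd_eq_cs]
    rw [Finset.sum_comm]
    refine Finset.sum_congr rfl fun l _ => Finset.sum_congr rfl fun k _ => ?_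
    rw [(hxx k l).cs_symm, star_star]
    ring
  have hpq : ∀ i, CrossStat μ (((1 + delay Ω) ^ N.l) (p i)) (((1 + delay Ω) ^ N.l) (p i)) :=
    fun i => (hasResponse_one_add_delay ω N.l _ _
      ((hasResponse_one_add_delay ω N.l _ _ (hpp i i)).1.symm)).1
  have h2 : cs μ (N.residual x i) (N.residual x j) ω = q * star q * psd μ p ω i j := by
    rw [CrossStat.congr_ae (N.residual_ae hdyn i) (N.residual_ae hdyn j)]
    have ha := hasResponse_one_add_delay (μ := μ) ω N.l _ _ (hpp j i)
    have hb := hasResponse_one_add_delay (μ := μ) ω N.l _ _ ha.1.symm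
    rw [hb.2, ha.1.cs_symm, ha.2, (hpp i j).cs_symm, psd_eq_cs, ← hq, star_mul', star_star,
      mul_assoc]
  -- The factor `(1 + z⁻¹)^l` enters both spectra with its conjugate, so it cancels off `z = -1`.
  have hqq : q * star q ≠ 0 := mul_ne_zero hq0 (star_ne_zero.2 hq0)
  exact mul_left_cancel₀ hqq (h1.symm.trans h2)

theorem psd_eq_diagonal {p : Fin n → ℤ → Ω → ℝ} [IsProbabilityMeasure μ]
    (hp : IsJWSS μ p) (hp_psd : HasPSD μ p)
    (hp_mean : ∀ i k, ∫ w, p i k w ∂μ = 0)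
    (hp_uncorr : ∀ i j, i ≠ j → ∀ k h, cov[p i k, p j h; μ] = 0) (ω : ℝ) :
    psd μ p ω = diagonal fun r => ((psd μ p ω r r).re : ℂ) := by
  ext i j
  rcases eq_or_ne i j with rfl | hij
  · rw [diagonal_apply_eq, psd_eq_cs]
    have := (hp.crossStat hp_psd i i).cs_symm ω
    exact (Complex.conj_eq_iff_re.1 this.symm).symm
  · rw [diagonal_apply_ne _ hij, psd_eq_cs, cs]
    have : ∀ k, ∫ w, p i k w * p j 0 w ∂μ = 0 := fun k => by
      have := ProbabilityTheory.covariance_eq_sub (hp.memLp i k) (hp.memLp j 0)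
      rw [hp_uncorr i j hij, hp_mean, zero_mul, sub_zero] at this
      exact this.symm
    simp [this]

end Network

end Dynamics

/-! ### The pole at `z = -1`, null sets and limits along good frequencies. -/

open Matrix

theorem one_add_exp_ne_zero {ω : ℝ} (hω : ω ∈ Set.Ioo (-Real.pi) Real.pi) :
    1 + Complex.exp (-(Complex.I * (ω : ℂ))) ≠ 0 := by
  intro h
  have h1 : Complex.exp (-(Complex.I * (ω : ℂ))) = Complex.exp (Real.pi * Complex.I) := by
    rw [Complex.exp_pi_mul_I]; linear_combination h
  obtain ⟨k, hk⟩ := Complex.exp_eq_exp_iff_exists_int.1 h1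
  have h2 : -ω = Real.pi + k * (2 * Real.pi) := by
    have := congrArg Complex.im hk
    simpa using this
  have hpi := Real.pi_pos
  have h3 : (k : ℝ) < 0 := by
    by_contra h0
    push Not at h0
    have := mul_nonneg h0 (by positivity : (0 : ℝ) ≤ 2 * Real.pi)
    linarith [hω.1]
  have h4 : (-1 : ℝ) < k := by
    by_contra h0
    push Not at h0
    have := mul_le_mul_of_nonneg_right h0 (by positivity : (0 : ℝ) ≤ 2 * Real.pi)
    linarith [hω.2]
  have h5 : k < 0 := by exact_mod_cast h3
  have h6 : -1 < k := by exact_mod_cast h4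
  omega

/-- The derivative in the frequency never vanishes, so zeros are isolated; this covers `±π` as well.
-/
theorem eventually_one_add_exp_ne_zero (ω : ℝ) :
    ∀ᶠ ξ : ℝ in 𝓝[≠] ω, 1 + Complex.exp (-(Complex.I * (ξ : ℂ))) ≠ 0 := by
  have h : HasDerivAt (fun ξ : ℝ => 1 + Complex.exp (-(Complex.I * (ξ : ℂ))))
      (Complex.exp (-(Complex.I * (ω : ℂ))) * (-(Complex.I * 1))) ω := by
    have h1 : HasDerivAt (fun ξ : ℝ => -(Complex.I * (ξ : ℂ))) (-(Complex.I * 1)) ω :=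
      ((hasDerivAt_id ω).ofReal_comp.const_mul Complex.I).neg
    exact h1.cexp.const_add 1
  exact h.eventually_ne (by simp [Complex.exp_ne_zero, Complex.I_ne_zero])

theorem ae_of_ae_Ioo {P : ℝ → Prop}
    (h : ∀ᵐ ω : ℝ ∂(volume.restrict (Set.Icc (-Real.pi) Real.pi)),
      ω ∈ Set.Ioo (-Real.pi) Real.pi → P ω) :
    ∀ᵐ ω : ℝ ∂(volume.restrict (Set.Icc (-Real.pi) Real.pi)), P ω := by
  rw [Measure.restrict_congr_set Ioo_ae_eq_Icc.symm] at h ⊢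
  filter_upwards [h, ae_restrict_mem measurableSet_Ioo] with ω h1 h2 using h1 h2

theorem restrict_Icc_ne_zero : volume.restrict (Set.Icc (-Real.pi) Real.pi) ≠ 0 := by
  rw [Ne, Measure.restrict_eq_zero, Real.volume_Icc]
  simp [Real.pi_pos]

/-- A set of full measure is dense, so every frequency of the closed interval, endpoints included,
is a limit of interior good ones. -/
theorem neBot_nhdsWithin_of_ae {P : ℝ → Prop}
    (h : ∀ᵐ ω : ℝ ∂(volume.restrict (Set.Icc (-Real.pi) Real.pi)), P ω)
    {ω : ℝ} (hω : ω ∈ Set.Icc (-Real.pi) Real.pi) :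
    (𝓝[{ξ | P ξ ∧ ξ ∈ Set.Ioo (-Real.pi) Real.pi}] ω).NeBot := by
  rw [← mem_closure_iff_nhdsWithin_neBot]
  have hd : Dense {ξ : ℝ | ξ ∈ Set.Icc (-Real.pi) Real.pi → P ξ} :=
    Measure.dense_of_ae ((ae_restrict_iff' measurableSet_Icc).1 h)
  have h1 : Set.Icc (-Real.pi) Real.pi ⊆ closure (Set.Ioo (-Real.pi) Real.pi) := by
    rw [closure_Ioo (by linarith [Real.pi_pos])]
  refine closure_minimal ?_ isClosed_closure (h1 hω)
  refine (hd.open_subset_closure_inter isOpen_Ioo).trans (closure_mono ?_)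
  exact fun ξ hξ => ⟨hξ.2 (Set.Ioo_subset_Icc_self hξ.1), hξ.1⟩

/-! ### The generative graph and the entries of `Mᴴ D⁻¹ M`. -/

namespace Network

variable {n : ℕ} (N : Network n)

theorem b_ne_zero_of_isEdge {i j : Fin n} (h : N.IsEdge i j) : i ≠ j ∧ N.b i j ≠ 0 := by
  have : NeZero (volume.restrict (Set.Icc (-Real.pi) Real.pi)) := ⟨restrict_Icc_ne_zero⟩
  obtain ⟨ω, hω⟩ := Eventually.exists (f := ae (volume.restrict (Set.Icc (-Real.pi) Real.pi))) h
  unfold H at hω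
  split_ifs at hω with hij
  · exact absurd rfl hω
  · refine ⟨hij, fun hb => hω ?_⟩
    simp [hb]

/-- `S_i` is a polynomial in the bilinear variable `s`, with constant term `∑ b_{ik} > 0`, so it has
finitely many zeros; `s` is injective on the open interval, so `S_i` vanishes at finitely many
frequencies there. -/
theorem isEdge_of_b_ne_zero {i j : Fin n} (hij : i ≠ j) (hb : N.b i j ≠ 0) : N.IsEdge i j := by
  have hbpos : 0 < N.b i j := (N.b_nonneg i j hij).lt_of_ne hb.symm
  have hβ : 0 < ∑ k ∈ Finset.univ.erase i, N.b i k :=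
    hbpos.trans_le (Finset.single_le_sum (f := fun k => N.b i k)
      (fun k hk => N.b_nonneg i k (Finset.ne_of_mem_erase hk).symm)
      (Finset.mem_erase.2 ⟨hij.symm, Finset.mem_univ j⟩))
  let P : Polynomial ℂ := ∑ m ∈ Finset.Icc 1 N.l, Polynomial.C (N.a m i : ℂ) * Polynomial.X ^ m
    + Polynomial.C (∑ k ∈ Finset.univ.erase i, (N.b i k : ℂ))
  have hP : P ≠ 0 := by
    intro h0
    have h1 : P.eval 0 = ((∑ k ∈ Finset.univ.erase i, N.b i k : ℝ) : ℂ) := by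
      simp only [P, Polynomial.eval_add, Polynomial.eval_finsetSum, Polynomial.eval_mul,
        Polynomial.eval_C, Polynomial.eval_pow, Polynomial.eval_X, Complex.ofReal_sum]
      rw [Finset.sum_eq_zero, zero_add]
      intro m hm
      rw [zero_pow (by have := (Finset.mem_Icc.1 hm).1; omega), mul_zero]
    rw [h0, Polynomial.eval_zero] at h1
    exact hβ.ne (by exact_mod_cast h1)
  let s : ℝ → ℂ := fun ω => 2 * (1 - (Complex.exp (Complex.I * (ω : ℂ)))⁻¹) /
    ((N.Δt : ℂ) * (1 + (Complex.exp (Complex.I * (ω : ℂ)))⁻¹))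
  have hS : ∀ ω : ℝ, N.S i (Complex.exp (Complex.I * (ω : ℂ))) = P.eval (s ω) := by
    intro ω
    simp [P, S, s, Polynomial.eval_finsetSum]
  have hΔ : (N.Δt : ℂ) ≠ 0 := by exact_mod_cast N.Δt_pos.ne'
  -- A Möbius map of `z⁻¹` is injective off its pole, and the exponential is injective on an open
  -- interval of length `2π`.
  have hinj : Set.InjOn s (Set.Ioo (-Real.pi) Real.pi) := by
    intro u hu v hv huv
    have hu' := one_add_exp_ne_zero hu
    have hv' := one_add_exp_ne_zero hv
    simp only [s, ← Complex.exp_neg] at huv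
    rw [div_eq_div_iff (mul_ne_zero hΔ hu') (mul_ne_zero hΔ hv')] at huv
    have h4 : Complex.exp (-(Complex.I * (u : ℂ))) = Complex.exp (-(Complex.I * (v : ℂ))) := by
      have : (4 * (N.Δt : ℂ)) * (Complex.exp (-(Complex.I * (u : ℂ)))
        - Complex.exp (-(Complex.I * (v : ℂ)))) = 0 := by linear_combination -huv
      exact sub_eq_zero.1 ((mul_eq_zero.1 this).resolve_left (mul_ne_zero (by norm_num) hΔ))
    obtain ⟨k, hk⟩ := Complex.exp_eq_exp_iff_exists_int.1 h4
    have h2 : -u = -v + k * (2 * Real.pi) := by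
      have := congrArg Complex.im hk
      simpa using this
    have hpi := Real.pi_pos
    have h3 : (k : ℝ) < 1 := by
      by_contra h0
      push Not at h0
      have := mul_le_mul_of_nonneg_right h0 (by positivity : (0 : ℝ) ≤ 2 * Real.pi)
      linarith [hu.1, hv.2]
    have h4 : (-1 : ℝ) < k := by
      by_contra h0
      push Not at h0
      have := mul_le_mul_of_nonneg_right h0 (by positivity : (0 : ℝ) ≤ 2 * Real.pi)
      linarith [hu.2, hv.1]
    have h5 : k < 1 := by exact_mod_cast h3
    have h6 : -1 < k := by exact_mod_cast h4
    have h7 : k = 0 := by omega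
    rw [h7] at h2
    simp only [Int.cast_zero, zero_mul, add_zero] at h2
    linarith
  have hfin : {ω : ℝ | ω ∈ Set.Ioo (-Real.pi) Real.pi ∧ P.eval (s ω) = 0}.Finite := by
    refine Set.Finite.of_finite_image (f := s) ?_ (hinj.mono fun ω h => h.1)
    refine (Polynomial.finite_setOfPred_isRoot hP).subset ?_
    rintro _ ⟨ω, hω, rfl⟩
    exact hω.2
  refine ae_of_ae_Ioo (ae_restrict_of_ae ?_)
  filter_upwards [hfin.countable.ae_notMem volume] with ω hω hmem
  rw [H, if_neg hij]
  refine div_ne_zero (by exact_mod_cast hb) fun h0 => hω ⟨hmem, ?_⟩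
  rw [← hS, h0]

theorem StrictSpouses.exists_child {N : Network n} {i j : Fin n} (h : N.StrictSpouses i j) :
    N.b j i = 0 ∧ N.b i j = 0 ∧ ∃ r, r ≠ i ∧ r ≠ j ∧ 0 < N.b r j * N.b r i := by
  obtain ⟨hij, ⟨r, hri, hrj⟩, hadj⟩ := h
  have hnot : ¬ N.IsEdge i j ∧ ¬ N.IsEdge j i := by
    rw [topology, SimpleGraph.fromRel_adj] at hadj
    tauto
  have h1 := N.b_ne_zero_of_isEdge hri
  have h2 := N.b_ne_zero_of_isEdge hrj
  refine ⟨?_, ?_, r, h1.1, h2.1, mul_pos ((N.b_nonneg _ _ h2.1).lt_of_ne h2.2.symm)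
    ((N.b_nonneg _ _ h1.1).lt_of_ne h1.2.symm)⟩
  · by_contra hb
    exact hnot.2 (N.isEdge_of_b_ne_zero hij.symm hb)
  · by_contra hb
    exact hnot.1 (N.isEdge_of_b_ne_zero hij hb)

/-- The off-diagonal entry of `Mᴴ D⁻¹ M` for nodes that are not neighbors. -/
theorem sum_dynMatrix_of_not_neighbors {i j : Fin n} (hij : i ≠ j) (h1 : N.b j i = 0)
    (h2 : N.b i j = 0) (ω : ℝ) (d : Fin n → ℝ) :
    ∑ r, star (N.dynMatrix ω r j) * (d r : ℂ)⁻¹ * N.dynMatrix ω r i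
      = ((∑ r ∈ (Finset.univ.erase j).erase i, N.b r j * N.b r i / d r : ℝ) : ℂ) := by
  rw [← Finset.add_sum_erase _ _ (Finset.mem_univ j),
    ← Finset.add_sum_erase _ _ (Finset.mem_erase.2 ⟨hij, Finset.mem_univ i⟩)]
  have hj : N.dynMatrix ω j i = 0 := by rw [dynMatrix, of_apply, if_neg hij.symm]; simp [h1]
  have hi : N.dynMatrix ω i j = 0 := by rw [dynMatrix, of_apply, if_neg hij]; simp [h2]
  rw [hj, hi, mul_zero, star_zero, zero_mul, zero_mul, zero_add, zero_add, Complex.ofReal_sum]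
  refine Finset.sum_congr rfl fun r hr => ?_
  have hri := Finset.ne_of_mem_erase hr
  have hrj := Finset.ne_of_mem_erase (Finset.mem_of_mem_erase hr)
  simp only [dynMatrix, of_apply, if_neg hri, if_neg hrj, star_neg, Complex.star_def,
    Complex.conj_ofReal, Complex.ofReal_div, Complex.ofReal_mul]
  ring

theorem sum_dynMatrix_diag (j : Fin n) (ω : ℝ) (d : Fin n → ℝ) :
    ∑ r, star (N.dynMatrix ω r j) * (d r : ℂ)⁻¹ * N.dynMatrix ω r j
      = ((Complex.normSq (N.S j (Complex.exp (Complex.I * (ω : ℂ)))) / d j +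
        ∑ r ∈ Finset.univ.erase j, N.b r j ^ 2 / d r : ℝ) : ℂ) := by
  rw [← Finset.add_sum_erase _ _ (Finset.mem_univ j), Complex.ofReal_add, Complex.ofReal_sum]
  congr 1
  · simp only [dynMatrix, of_apply, if_true, Complex.ofReal_div, Complex.star_def,
      Complex.normSq_eq_conj_mul_self]
    ring
  · refine Finset.sum_congr rfl fun r hr => ?_
    simp only [dynMatrix, of_apply, if_neg (Finset.ne_of_mem_erase hr), star_neg, Complex.star_def,
      Complex.conj_ofReal, Complex.ofReal_div, Complex.ofReal_pow]
    ring

theorem exists_tendsto_S (j : Fin n) {ω : ℝ} (h : ω ∈ Set.Ioo (-Real.pi) Real.pi ∨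
    ∀ m ∈ Finset.Icc 1 N.l, N.a m j = 0) :
    ∃ c, Tendsto (fun ξ : ℝ => N.S j (Complex.exp (Complex.I * (ξ : ℂ)))) (𝓝[≠] ω) (𝓝 c) := by
  rcases h with h | h
  · refine ⟨N.S j (Complex.exp (Complex.I * (ω : ℂ))), Tendsto.mono_left ?_ nhdsWithin_le_nhds⟩
    have hΔ : (N.Δt : ℂ) ≠ 0 := by exact_mod_cast N.Δt_pos.ne'
    have hne := mul_ne_zero hΔ (one_add_exp_ne_zero h)
    simp only [S, ← Complex.exp_neg]
    refine Tendsto.add (tendsto_finsetSum _ fun m _ => Tendsto.const_mul _ (Tendsto.pow ?_ _))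
      tendsto_const_nhds
    refine Tendsto.div ?_ ?_ hne
    · exact (by fun_prop : Continuous fun ξ : ℝ =>
        2 * (1 - Complex.exp (-(Complex.I * (ξ : ℂ))))).tendsto ω
    · exact (by fun_prop : Continuous fun ξ : ℝ =>
        (N.Δt : ℂ) * (1 + Complex.exp (-(Complex.I * (ξ : ℂ))))).tendsto ω
  · refine ⟨∑ k ∈ Finset.univ.erase j, (N.b j k : ℂ), ?_⟩
    have : ∀ z, N.S j z = ∑ k ∈ Finset.univ.erase j, (N.b j k : ℂ) := fun z => by
      rw [S, Finset.sum_eq_zero fun m hm => by rw [h m hm]; simp, zero_add]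
    simp only [this]
    exact tendsto_const_nhds

end Network

/-! ### The phase of the Wiener filter and its limits. -/

section Phase

variable {Ω : Type*} [MeasurableSpace Ω] {μ : Measure Ω} {n : ℕ} {N : Network n}
  {x : Fin n → ℤ → Ω → ℝ}

theorem continuous_psd (hx : IsJWSS μ x) (hx_psd : HasPSD μ x) : Continuous (psd μ x) :=
  continuous_matrix fun i j => (hx.crossStat hx_psd i j).continuous_cs

/-- Nonnegativity of a periodic continuous function which is positive almost everywhere on a
period. -/
theorem nonneg_of_ae_pos {f : ℝ → ℝ} (hf : Continuous f) (hper : Function.Periodic f (2 * Real.pi))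
    (hpos : ∀ᵐ ω : ℝ ∂(volume.restrict (Set.Icc (-Real.pi) Real.pi)), 0 < f ω) (ω : ℝ) :
    0 ≤ f ω := by
  obtain ⟨ξ, hξ, hfξ⟩ := hper.exists_mem_Ico (by linarith [Real.pi_pos]) ω (-Real.pi)
  rw [hfξ]
  have hmem : ξ ∈ Set.Icc (-Real.pi) Real.pi := ⟨hξ.1, by linarith [hξ.2]⟩
  have := neBot_nhdsWithin_of_ae hpos hmem
  refine ge_of_tendsto ((hf.tendsto ξ).mono_left (nhdsWithin_le_nhds
    (s := {u | 0 < f u ∧ u ∈ Set.Ioo (-Real.pi) Real.pi}))) ?_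
  filter_upwards [self_mem_nhdsWithin] with u hu using hu.1.le

theorem arg_neg_div_eq_pi {z w : ℂ} (hz : 0 < z) (hw : 0 < w) : (-(z / w)).arg = Real.pi := by
  rw [Complex.arg_eq_pi_iff]
  have h := div_pos hz hw
  rw [Complex.pos_iff] at h
  exact ⟨by simpa using h.1, by simpa using h.2.symm⟩

variable {d : ℝ → Fin n → ℝ}

theorem arg_wienerFilter_eq_pi
    (hrel : ∀ ω : ℝ, 1 + Complex.exp (-(Complex.I * (ω : ℂ))) ≠ 0 →
      N.dynMatrix ω * psd μ x ω * (N.dynMatrix ω)ᴴ = diagonal fun r => (d ω r : ℂ))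
    (hcont : Continuous (psd μ x)) (hd : Continuous d)
    (hpos : ∀ᵐ ω : ℝ ∂(volume.restrict (Set.Icc (-Real.pi) Real.pi)), ∀ r, 0 < d ω r)
    {i j : Fin n} (hs : N.StrictSpouses i j) {ω : ℝ} (hω : ω ∈ Set.Icc (-Real.pi) Real.pi)
    (hΦ : (psd μ x ω).PosDef) :
    (wienerFilter μ x j ω ⟨i, hs.1⟩).arg = Real.pi := by
  rw [wienerFilter_eq_inv hΦ]
  refine arg_neg_div_eq_pi ?_ hΦ.inv.diag_pos
  obtain ⟨h1, h2, r, hri, hrj, hr⟩ := hs.exists_child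
  have hdet : (psd μ x ω).det ≠ 0 := hΦ.det_pos.ne'
  have hinv : Tendsto (fun ξ => (psd μ x ξ)⁻¹ j i) (𝓝 ω) (𝓝 ((psd μ x ω)⁻¹ j i)) := by
    simp only [inv_def, Ring.inverse_eq_inv', Matrix.smul_apply, smul_eq_mul]
    exact ((hcont.matrix_det.tendsto ω).inv₀ hdet).mul
      (((hcont.matrix_adjugate).matrix_elem j i).tendsto ω)
  have := neBot_nhdsWithin_of_ae hpos hω
  have hval : ∀ ξ, (∀ r, 0 < d ξ r) → ξ ∈ Set.Ioo (-Real.pi) Real.pi →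
      (psd μ x ξ)⁻¹ j i =
        ((∑ r ∈ (Finset.univ.erase j).erase i, N.b r j * N.b r i / d ξ r : ℝ) : ℂ) := by
    intro ξ hξ hmem
    rw [(posDef_and_inv_of_congr_diagonal hξ (hrel ξ (one_add_exp_ne_zero hmem))).2,
      N.sum_dynMatrix_of_not_neighbors hs.1 h1 h2]
  have hterm : ∀ ξ, (∀ r, 0 < d ξ r) → ∀ r ∈ (Finset.univ.erase j).erase i,
      0 ≤ N.b r j * N.b r i / d ξ r := fun ξ hξ r hr =>
    div_nonneg (mul_nonneg (N.b_nonneg _ _ (Finset.ne_of_mem_erase (Finset.mem_of_mem_erase hr)))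
      (N.b_nonneg _ _ (Finset.ne_of_mem_erase hr))) (hξ r).le
  have hF := nhdsWithin_le_nhds (a := ω)
    (s := {ξ | (∀ r, 0 < d ξ r) ∧ ξ ∈ Set.Ioo (-Real.pi) Real.pi})
  have him : ((psd μ x ω)⁻¹ j i).im = 0 := by
    refine tendsto_nhds_unique (((Complex.continuous_im.tendsto _).comp hinv).mono_left hF)
      (tendsto_const_nhds.congr' ?_)
    filter_upwards [self_mem_nhdsWithin] with ξ hξ
    rw [Function.comp_apply, hval ξ hξ.1 hξ.2, Complex.ofReal_im]
  have hre : 0 ≤ ((psd μ x ω)⁻¹ j i).re := by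
    refine ge_of_tendsto (((Complex.continuous_re.tendsto _).comp hinv).mono_left hF) ?_
    filter_upwards [self_mem_nhdsWithin] with ξ hξ
    rw [Function.comp_apply, hval ξ hξ.1 hξ.2, Complex.ofReal_re]
    exact Finset.sum_nonneg (hterm ξ hξ.1)
  -- Multiplied by `d_r`, the bound by a single summand passes to the limit even if `d_r` vanishes
  -- at `ω`; it excludes `K_{ji} = 0`.
  have hmul : N.b r j * N.b r i ≤ ((psd μ x ω)⁻¹ j i).re * d ω r := by
    refine ge_of_tendsto ((((Complex.continuous_re.tendsto _).comp hinv).mul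
      (((continuous_apply r).comp hd).tendsto ω)).mono_left hF) ?_
    filter_upwards [self_mem_nhdsWithin] with ξ hξ
    rw [Function.comp_apply, hval ξ hξ.1 hξ.2, Complex.ofReal_re, Function.comp_apply,
      ← div_le_iff₀ (hξ.1 r)]
    exact Finset.single_le_sum (hterm ξ hξ.1)
      (Finset.mem_erase.2 ⟨hri, Finset.mem_erase.2 ⟨hrj, Finset.mem_univ r⟩⟩)
  rw [Complex.pos_iff]
  refine ⟨hre.lt_of_ne fun h0 => ?_, him.symm⟩
  rw [← h0, zero_mul] at hmul
  linarith

theorem exists_tendsto_wienerFilter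
    (hrel : ∀ ω : ℝ, 1 + Complex.exp (-(Complex.I * (ω : ℂ))) ≠ 0 →
      N.dynMatrix ω * psd μ x ω * (N.dynMatrix ω)ᴴ = diagonal fun r => (d ω r : ℂ))
    (hnonneg : ∀ ω r, 0 ≤ d ω r)
    {i j : Fin n} (hs : N.StrictSpouses i j) {ω : ℝ}
    (hpole : ω ∈ Set.Ioo (-Real.pi) Real.pi ∨ ∀ m ∈ Finset.Icc 1 N.l, N.a m j = 0)
    (hratio : ∀ r, ∃ c : ℝ, 0 < c ∧
      Tendsto (fun ξ => d ξ r / d ξ j) (𝓝[≠] ω) (𝓝 c)) :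
    ∃ c : ℂ, Tendsto (fun ξ => wienerFilter μ x j ξ ⟨i, hs.1⟩) (𝓝[≠] ω) (𝓝 c) ∧
      c.arg = Real.pi := by
  obtain ⟨h1, h2, r₀, hri, hrj, hr⟩ := hs.exists_child
  choose c hc hlim using hratio
  obtain ⟨s, hS⟩ := N.exists_tendsto_S j hpole
  have hinv : ∀ r, Tendsto (fun ξ => d ξ j / d ξ r) (𝓝[≠] ω) (𝓝 (c r)⁻¹) := fun r => by
    simpa only [inv_div] using (hlim r).inv₀ (hc r).ne'
  -- A ratio near its positive limit has nonzero numerator; the case `r = j` covers `d_j`.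
  have hpos : ∀ᶠ ξ in 𝓝[≠] ω, ∀ r, 0 < d ξ r := by
    rw [eventually_all]
    intro r
    filter_upwards [(hlim r).eventually (lt_mem_nhds (hc r))] with ξ hξ
    refine (hnonneg ξ r).lt_of_ne fun h0 => ?_
    rw [← h0, zero_div] at hξ
    exact lt_irrefl _ hξ
  have hval : ∀ᶠ ξ in 𝓝[≠] ω,
      ((-((∑ r ∈ (Finset.univ.erase j).erase i, N.b r j * N.b r i * (d ξ j / d ξ r)) /
        (Complex.normSq (N.S j (Complex.exp (Complex.I * (ξ : ℂ)))) +
          ∑ r ∈ Finset.univ.erase j, N.b r j ^ 2 * (d ξ j / d ξ r))) : ℝ) : ℂ)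
      = wienerFilter μ x j ξ ⟨i, hs.1⟩ := by
    filter_upwards [hpos, eventually_one_add_exp_ne_zero ω] with ξ hξ hne
    have hK := posDef_and_inv_of_congr_diagonal hξ (hrel ξ hne)
    rw [wienerFilter_eq_inv hK.1, hK.2, hK.2, N.sum_dynMatrix_of_not_neighbors hs.1 h1 h2,
      N.sum_dynMatrix_diag, ← Complex.ofReal_div, ← Complex.ofReal_neg]
    congr 2
    have hj := (hξ j).ne'
    have e1 : ∑ r ∈ (Finset.univ.erase j).erase i, N.b r j * N.b r i * (d ξ j / d ξ r)
        = d ξ j * ∑ r ∈ (Finset.univ.erase j).erase i, N.b r j * N.b r i / d ξ r := by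
      rw [Finset.mul_sum]; exact Finset.sum_congr rfl fun r _ => by ring
    have e2 : Complex.normSq (N.S j (Complex.exp (Complex.I * (ξ : ℂ)))) +
          ∑ r ∈ Finset.univ.erase j, N.b r j ^ 2 * (d ξ j / d ξ r)
        = d ξ j * (Complex.normSq (N.S j (Complex.exp (Complex.I * (ξ : ℂ)))) / d ξ j +
          ∑ r ∈ Finset.univ.erase j, N.b r j ^ 2 / d ξ r) := by
      rw [mul_add, mul_div_cancel₀ _ hj, Finset.mul_sum]
      congr 1
      exact Finset.sum_congr rfl fun r _ => by ring
    rw [e1, e2, mul_div_mul_left _ _ hj]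
  have hmem : r₀ ∈ (Finset.univ.erase j).erase i :=
    Finset.mem_erase.2 ⟨hri, Finset.mem_erase.2 ⟨hrj, Finset.mem_univ _⟩⟩
  have hnum : 0 < ∑ r ∈ (Finset.univ.erase j).erase i, N.b r j * N.b r i * (c r)⁻¹ := by
    refine Finset.sum_pos' (fun r hr' => ?_) ⟨r₀, hmem, mul_pos hr (inv_pos.2 (hc _))⟩
    exact mul_nonneg (mul_nonneg
      (N.b_nonneg _ _ (Finset.ne_of_mem_erase (Finset.mem_of_mem_erase hr')))
      (N.b_nonneg _ _ (Finset.ne_of_mem_erase hr'))) (inv_pos.2 (hc _)).le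
  -- The edge from `j` to the common child keeps the denominator positive even when `S_j` tends to
  -- zero.
  have hden : 0 < Complex.normSq s + ∑ r ∈ Finset.univ.erase j, N.b r j ^ 2 * (c r)⁻¹ := by
    refine add_pos_of_nonneg_of_pos (Complex.normSq_nonneg _) (Finset.sum_pos'
      (fun r _ => mul_nonneg (sq_nonneg _) (inv_pos.2 (hc _)).le)
      ⟨r₀, Finset.mem_of_mem_erase hmem, mul_pos ?_ (inv_pos.2 (hc _))⟩)
    exact pow_pos ((N.b_nonneg _ _ hrj).lt_of_ne fun h0 => by simp [← h0] at hr) 2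
  have hT : Tendsto (fun ξ =>
      -((∑ r ∈ (Finset.univ.erase j).erase i, N.b r j * N.b r i * (d ξ j / d ξ r)) /
        (Complex.normSq (N.S j (Complex.exp (Complex.I * (ξ : ℂ)))) +
          ∑ r ∈ Finset.univ.erase j, N.b r j ^ 2 * (d ξ j / d ξ r)))) (𝓝[≠] ω)
      (𝓝 (-((∑ r ∈ (Finset.univ.erase j).erase i, N.b r j * N.b r i * (c r)⁻¹) /
        (Complex.normSq s + ∑ r ∈ Finset.univ.erase j, N.b r j ^ 2 * (c r)⁻¹)))) := by
    refine Tendsto.neg (Tendsto.div (tendsto_finsetSum _ fun r _ => (hinv r).const_mul _)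
      (Tendsto.add ((Complex.continuous_normSq.tendsto s).comp hS)
        (tendsto_finsetSum _ fun r _ => (hinv r).const_mul _)) hden.ne')
  refine ⟨_, (((Complex.continuous_ofReal.tendsto _).comp hT).congr' hval), ?_⟩
  rw [Complex.ofReal_neg, Complex.ofReal_div]
  exact arg_neg_div_eq_pi (by exact_mod_cast hnum) (by exact_mod_cast hden)

end Phase

/-! ### Fourier uniqueness and orthogonality of least squares errors. -/

/-- A square integrable function on `[-π, π]` with vanishing Fourier coefficients is zero. -/
theorem ae_eq_zero_of_fourier_eq_zero {F : ℝ → ℂ}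
    (hF : MemLp F 2 (volume.restrict (Set.Icc (-Real.pi) Real.pi)))
    (h0 : ∀ k : ℤ, ∫ ω in Set.Icc (-Real.pi) Real.pi,
      F ω * Complex.exp (Complex.I * (ω : ℂ) * (k : ℂ)) = 0) :
    ∀ᵐ ω ∂(volume.restrict (Set.Icc (-Real.pi) Real.pi)), F ω = 0 := by
  have hab : -Real.pi < Real.pi := by linarith [Real.pi_pos]
  rw [← Measure.restrict_congr_set Ioc_ae_eq_Icc] at hF h0 ⊢
  have hcoef : ∀ k, fourierCoeffOn hab F k = 0 := by
    intro k
    rw [fourierCoeffOn_eq_integral, intervalIntegral.integral_of_le hab.le]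
    have : ∀ ω : ℝ, fourier (-k) (ω : AddCircle (Real.pi - -Real.pi)) • F ω
        = F ω * Complex.exp (Complex.I * (ω : ℂ) * ((-k : ℤ) : ℂ)) := by
      intro ω
      rw [fourier_coe_apply, smul_eq_mul, mul_comm]
      congr 2
      have : (Real.pi : ℂ) ≠ 0 := by exact_mod_cast Real.pi_ne_zero
      push_cast
      field_simp
      ring
    simp only [this, h0, smul_zero]
  have hsum := hasSum_sq_fourierCoeffOn hab hF
  simp only [hcoef, norm_zero, ne_eq, OfNat.ofNat_ne_zero, not_false_eq_true, zero_pow] at hsum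
  have hint := hsum.unique hasSum_zero
  rw [smul_eq_mul, mul_eq_zero, or_iff_right (inv_ne_zero (sub_pos.2 hab).ne'),
    intervalIntegral.integral_of_le hab.le,
    integral_eq_zero_iff_of_nonneg (fun _ => sq_nonneg _) (hF.integrable_norm_pow (by norm_num))]
    at hint
  filter_upwards [hint] with ω hω
  simpa using hω

/-- A function on `[-π, π]` that is a mean square limit of continuous functions whose Fourier
coefficients tend to zero is zero. -/
theorem ae_eq_zero_of_tendsto_fourier {F : ℝ → ℂ} {G : ℕ → ℝ → ℂ}
    (hF : AEStronglyMeasurable F (volume.restrict (Set.Icc (-Real.pi) Real.pi)))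
    (hG : ∀ r, Continuous (G r))
    (hlim : Tendsto (fun r => ∫⁻ ω in Set.Icc (-Real.pi) Real.pi, ‖G r ω - F ω‖ₑ ^ 2)
      atTop (𝓝 0))
    (hcoef : ∀ k : ℤ, Tendsto (fun r => ∫ ω in Set.Icc (-Real.pi) Real.pi,
      G r ω * Complex.exp (Complex.I * (ω : ℂ) * (k : ℂ))) atTop (𝓝 0)) :
    ∀ᵐ ω ∂(volume.restrict (Set.Icc (-Real.pi) Real.pi)), F ω = 0 := by
  set ν := volume.restrict (Set.Icc (-Real.pi) Real.pi) with hν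
  have hmemG : ∀ r, MemLp (G r) 2 ν := fun r => by
    obtain ⟨C, hC⟩ := (isCompact_Icc (a := -Real.pi) (b := Real.pi)).exists_bound_of_continuousOn
      (hG r).continuousOn
    exact MemLp.of_bound (hG r).aestronglyMeasurable C
      ((ae_restrict_iff' measurableSet_Icc).2 (ae_of_all _ hC))
  have heL : ∀ r, eLpNorm (G r - F) 2 ν = (∫⁻ ω, ‖G r ω - F ω‖ₑ ^ 2 ∂ν) ^ (1 / 2 : ℝ) := by
    intro r
    rw [eLpNorm_eq_lintegral_rpow_enorm_toReal (by norm_num) (by norm_num)]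
    simp
  have h2 : Tendsto (fun r => eLpNorm (G r - F) 2 ν) atTop (𝓝 0) := by
    simp only [heL]
    have := (ENNReal.continuous_rpow_const (y := (1 / 2 : ℝ))).tendsto 0
    rw [ENNReal.zero_rpow_of_pos (by norm_num)] at this
    exact this.comp hlim
  have hmemF : MemLp F 2 ν := by
    obtain ⟨r, hr⟩ := (h2.eventually (gt_mem_nhds ENNReal.zero_lt_top)).exists
    have hsub : MemLp (G r - F) 2 ν := ⟨(hmemG r).1.sub hF, hr⟩
    simpa using (hmemG r).sub hsub
  -- On a finite measure space `L²` convergence implies `L¹` convergence, which passes to Fourier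
  -- coefficients.
  have h1 : Tendsto (fun r => eLpNorm (G r - F) 1 ν) atTop (𝓝 0) := by
    have hc : Tendsto (fun r => eLpNorm (G r - F) 2 ν *
        ν Set.univ ^ (1 / (1 : ENNReal).toReal - 1 / (2 : ENNReal).toReal)) atTop (𝓝 0) := by
      have := ENNReal.Tendsto.mul_const (b := ν Set.univ ^
        (1 / (1 : ENNReal).toReal - 1 / (2 : ENNReal).toReal)) h2
        (Or.inr (ENNReal.rpow_ne_top_of_nonneg (by norm_num) (measure_ne_top ν _)))
      rwa [zero_mul] at this
    exact tendsto_of_tendsto_of_tendsto_of_le_of_le tendsto_const_nhds hc (fun _ => zero_le)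
      fun r => eLpNorm_le_eLpNorm_mul_rpow_measure_univ (by norm_num) ((hmemG r).1.sub hF)
  refine ae_eq_zero_of_fourier_eq_zero hmemF fun k => ?_
  have hcexp : Continuous fun ω : ℝ => Complex.exp (Complex.I * (ω : ℂ) * (k : ℂ)) := by fun_prop
  refine tendsto_nhds_unique (tendsto_integral_of_L1 _ (hF.mul hcexp.aestronglyMeasurable)
    (Eventually.of_forall fun r => ?_) ?_) (hcoef k)
  · exact ((hG r).mul hcexp).integrableOn_Icc
  · simp_rw [eLpNorm_one_eq_lintegral_enorm] at h1
    refine h1.congr fun r => lintegral_congr fun ω => ?_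
    have hn : ‖Complex.exp (Complex.I * (ω : ℂ) * (k : ℂ))‖ₑ = 1 := by
      have := norm_exp_freq ω (-k)
      rw [Int.cast_neg, mul_neg, neg_neg] at this
      rw [← ofReal_norm, this, ENNReal.ofReal_one]
    rw [Pi.mul_apply, ← sub_mul, enorm_mul, hn, mul_one, Pi.sub_apply]

/-- Orthogonality of the residual of a least squares problem in a Hilbert space, for a minimizer
given as a limit. -/
theorem tendsto_inner_zero_of_minimal {H : Type*} [NormedAddCommGroup H] [InnerProductSpace ℝ H]
    {e y : H} {δ : ℕ → H} (hδ : Tendsto δ atTop (𝓝 0))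
    (hmin : ∀ r (t : ℝ), ‖e‖ ^ 2 ≤ ‖e + δ r - t • y‖ ^ 2) :
    Tendsto (fun r => inner ℝ (e + δ r) y) atTop (𝓝 0) := by
  have hlim : Tendsto (fun r => e + δ r) atTop (𝓝 e) := by simpa using hδ.const_add e
  have hmin' : ∀ t : ℝ, ‖e‖ ^ 2 ≤ ‖e - t • y‖ ^ 2 := fun t =>
    ge_of_tendsto ((hlim.sub_const (t • y)).norm.pow 2) (Eventually.of_forall fun r => hmin r t)
  have horth : inner ℝ e y = 0 := by
    set s : ℝ := inner ℝ e y with hs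
    -- The summand `1` avoids a case distinction at `y = 0`; this step length still forces `s = 0`.
    have h := hmin' (s / (‖y‖ ^ 2 + 1))
    rw [norm_sub_sq_real, inner_smul_right, norm_smul, mul_pow, ← hs, Real.norm_eq_abs, sq_abs] at h
    have hy : 0 < ‖y‖ ^ 2 + 1 := by positivity
    have h2 : 2 * (s / (‖y‖ ^ 2 + 1) * s) ≤ (s / (‖y‖ ^ 2 + 1)) ^ 2 * ‖y‖ ^ 2 := by linarith
    have h3 : s = (s / (‖y‖ ^ 2 + 1)) * (‖y‖ ^ 2 + 1) := by field_simp
    set t := s / (‖y‖ ^ 2 + 1)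
    rw [h3] at h2
    have ht : t = 0 := by
      have : t ^ 2 ≤ 0 := by nlinarith [mul_nonneg (sq_nonneg t) (sq_nonneg ‖y‖)]
      exact pow_eq_zero_iff (two_ne_zero) |>.1 (le_antisymm this (sq_nonneg t))
    rw [h3, ht, zero_mul]
  have := Tendsto.inner (𝕜 := ℝ) hlim (tendsto_const_nhds (x := y))
  rwa [horth] at this

/-- Changing one tap of the filter is the variation used in the minimization. -/
theorem firOutput_add_single {Ω : Type*} {n : ℕ} {x : Fin n → ℤ → Ω → ℝ} {j : Fin n}
    (c : {i : Fin n // i ≠ j} → ℤ →₀ ℝ)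
    (i : {i : Fin n // i ≠ j}) (L : ℤ) (t : ℝ) (k : ℤ) (w : Ω) :
    firOutput x (c + Pi.single i (Finsupp.single L t)) k w
      = firOutput x c k w + t * x i.1 (k - L) w := by
  unfold firOutput
  have : ∀ a, ((c + Pi.single i (Finsupp.single L t) : {i : Fin n // i ≠ j} → ℤ →₀ ℝ) a).sum
      (fun L c => c * x a.1 (k - L) w)
      = (c a).sum (fun L c => c * x a.1 (k - L) w) +
        (if a = i then t * x i.1 (k - L) w else 0) := by
    intro a
    rw [Pi.add_apply, Finsupp.sum_add_index' (fun _ => zero_mul _) fun _ _ _ => add_mul _ _ _]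
    congr 1
    rcases eq_or_ne a i with rfl | hai
    · rw [Pi.single_eq_same, if_pos rfl, Finsupp.sum_single_index (zero_mul _)]
    · rw [Pi.single_eq_of_ne hai, if_neg hai, Finsupp.sum_zero_index]
  simp only [this, Finset.sum_add_distrib, Finset.sum_ite_eq', Finset.mem_univ, if_true]

/-! ### The least squares filter solves the normal equations. -/

section LeastSquares

variable {Ω : Type*} [MeasurableSpace Ω] {μ : Measure Ω}

theorem inner_toLp {f g : Ω → ℝ} (hf : MemLp f 2 μ) (hg : MemLp g 2 μ) :
    inner ℝ (hf.toLp f) (hg.toLp g) = ∫ w, f w * g w ∂μ := by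
  rw [L2.inner_def]
  refine integral_congr_ae ?_
  filter_upwards [hf.coeFn_toLp, hg.coeFn_toLp] with w h1 h2
  rw [h1, h2, RCLike.inner_apply]
  simp [mul_comm]

theorem norm_toLp_sq {f : Ω → ℝ} (hf : MemLp f 2 μ) :
    ‖hf.toLp f‖ ^ 2 = ∫ w, f w ^ 2 ∂μ := by
  rw [← real_inner_self_eq_norm_sq, inner_toLp]
  simp only [sq]

theorem tendsto_integral_mul_of_minimal {a v y : Ω → ℝ} {u : ℕ → Ω → ℝ} (ha : MemLp a 2 μ)
    (hv : MemLp v 2 μ) (hy : MemLp y 2 μ) (hu : ∀ r, MemLp (u r) 2 μ)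
    (hlim : Tendsto (fun r => ∫ w, (v w - u r w) ^ 2 ∂μ) atTop (𝓝 0))
    (hmin : ∀ r (t : ℝ), ∫ w, (a w - v w) ^ 2 ∂μ ≤ ∫ w, (a w - (u r w + t * y w)) ^ 2 ∂μ) :
    Tendsto (fun r => ∫ w, (a w - u r w) * y w ∂μ) atTop (𝓝 0) := by
  have hδ : Tendsto (fun r => (hv.sub (hu r)).toLp (v - u r)) atTop (𝓝 0) := by
    rw [tendsto_zero_iff_norm_tendsto_zero]
    have h2 : Tendsto (fun r => ‖(hv.sub (hu r)).toLp (v - u r)‖ ^ 2) atTop (𝓝 0) := by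
      simpa only [norm_toLp_sq, Pi.sub_apply] using hlim
    simpa using h2.sqrt
  have h := tendsto_inner_zero_of_minimal (e := (ha.sub hv).toLp (a - v)) (y := hy.toLp y) hδ
    fun r t => by
      rw [← MemLp.toLp_add, ← MemLp.toLp_const_smul, ← MemLp.toLp_sub, norm_toLp_sq, norm_toLp_sq]
      refine (hmin r t).trans_eq (integral_congr_ae (ae_of_all _ fun w => ?_))
      simp only [Pi.add_apply, Pi.sub_apply, Pi.smul_apply, smul_eq_mul]
      ring
  refine h.congr fun r => ?_
  rw [← MemLp.toLp_add, inner_toLp]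
  refine integral_congr_ae (ae_of_all _ fun w => ?_)
  simp only [Pi.add_apply, Pi.sub_apply]
  ring

variable {n : ℕ} {x : Fin n → ℤ → Ω → ℝ}

theorem firOutput_crossStat {g : ℤ → Ω → ℝ} (h : ∀ i, CrossStat μ (x i) g)
    (hg : ∀ k, MemLp (g k) 2 μ)
    {j : Fin n} (c : {i : Fin n // i ≠ j} → ℤ →₀ ℝ) :
    CrossStat μ (firOutput x c) g ∧ ∀ ω, cs μ (firOutput x c) g ω
      = ∑ a, firResponse c ω a * cs μ (x a.1) g ω := by
  have heq : firOutput x c = ∑ a : {i : Fin n // i ≠ j}, ∑ L ∈ (c a).support,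
      c a L • fun k => x a.1 (k - L) := by
    funext k w
    simp [firOutput, Finsupp.sum, Finset.sum_apply]
  have hin : ∀ a : {i : Fin n // i ≠ j}, CrossStat μ (∑ L ∈ (c a).support,
      c a L • fun k => x a.1 (k - L)) g ∧ ∀ ω, cs μ (∑ L ∈ (c a).support,
      c a L • fun k => x a.1 (k - L)) g ω = firResponse c ω a * cs μ (x a.1) g ω := by
    intro a
    have hL := fun L : ℤ => ((h a.1).shift L).1.smul (c a L)
    have hs := CrossStat.sum (c a).support hg (F := fun L => c a L • fun k => x a.1 (k - L))
      fun L _ => (hL L).1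
    refine ⟨hs.1, fun ω => ?_⟩
    rw [hs.2, firResponse, Finsupp.sum, Finset.sum_mul]
    refine Finset.sum_congr rfl fun L _ => ?_
    rw [(hL L).2, ((h a.1).shift L).2]
    ring
  have hs := CrossStat.sum Finset.univ hg (F := fun a : {i : Fin n // i ≠ j} =>
    ∑ L ∈ (c a).support, c a L • fun k => x a.1 (k - L)) fun a _ => (hin a).1
  rw [heq]
  exact ⟨hs.1, fun ω => by rw [hs.2]; exact Finset.sum_congr rfl fun a _ => (hin a).2 ω⟩

/-- The solution of the least squares problem is the Wiener filter, at almost every frequency. -/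
theorem IsLeastSquaresResponse.ae_eq_wienerFilter (hx : IsJWSS μ x) (hx_psd : HasPSD μ x)
    (hpos : ∀ᵐ ω : ℝ ∂(volume.restrict (Set.Icc (-Real.pi) Real.pi)), (psd μ x ω).PosDef)
    {j : Fin n} {W : ℝ → {i : Fin n // i ≠ j} → ℂ} (hW : IsLeastSquaresResponse μ x j W) :
    ∀ᵐ ω : ℝ ∂(volume.restrict (Set.Icc (-Real.pi) Real.pi)), W ω = wienerFilter μ x j ω := by
  obtain ⟨hmeas, v, c, hv, hlim, hresp, hmin⟩ := hW
  have hxx := hx.crossStat hx_psd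
  have hfir : ∀ r i, CrossStat μ (firOutput x (c r)) (x i) ∧ ∀ ω,
      cs μ (firOutput x (c r)) (x i) ω = ∑ a, firResponse (c r) ω a * psd μ x ω a.1 i :=
    fun r i => firOutput_crossStat (fun k => hxx k i) (hx.memLp i) (c r)
  have hdiff := fun r i => (hxx j i).sub (hfir r i).1
  have hzero : ∀ i : {i : Fin n // i ≠ j},
      ∀ᵐ ω : ℝ ∂(volume.restrict (Set.Icc (-Real.pi) Real.pi)),
        psd μ x ω j i.1 - ∑ a, W ω a * psd μ x ω a.1 i.1 = 0 := by
    intro i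
    refine ae_eq_zero_of_tendsto_fourier
      (G := fun r => cs μ (x j - firOutput x (c r)) (x i.1)) ?_
      (fun r => (hdiff r i.1).1.continuous_cs) ?_ ?_
    · refine AEStronglyMeasurable.sub (hxx j i.1).continuous_cs.aestronglyMeasurable ?_
      refine Finset.aestronglyMeasurable_fun_sum _ fun a _ => ?_
      exact (hmeas a).aestronglyMeasurable.mul (hxx a.1 i.1).continuous_cs.aestronglyMeasurable
    · obtain ⟨C, hC⟩ := (isCompact_Icc (a := -Real.pi) (b := Real.pi)).exists_bound_of_continuousOn
        (hxx i.1 i.1).continuous_cs.continuousOn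
      have hup := ENNReal.Tendsto.const_mul (a := ENNReal.ofReal C) hresp
        (Or.inr ENNReal.ofReal_ne_top)
      rw [mul_zero] at hup
      refine tendsto_of_tendsto_of_tendsto_of_le_of_le tendsto_const_nhds hup (fun _ => zero_le)
        fun r => ?_
      simp only
      rw [← lintegral_const_mul' _ _ ENNReal.ofReal_ne_top]
      refine lintegral_mono_ae ?_
      filter_upwards [hpos, ae_restrict_mem measurableSet_Icc] with ω hω hmem
      -- Cauchy-Schwarz bounds the error in the `i`-th normal equation by the weighted error of the
      -- responses, with factor `Φ_{ii} ≤ C`.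
      have hCS := norm_sq_sum_mul_le (hω.submatrix (e := fun a : {i : Fin n // i ≠ j} => a.1)
        Subtype.val_injective) (fun a => W ω a - firResponse (c r) ω a) i
      simp only [submatrix_apply] at hCS
      have hre : (psd μ x ω i.1 i.1).re ≤ C := (Complex.re_le_norm _).trans (hC ω hmem)
      have hii : 0 < (psd μ x ω i.1 i.1).re := (Complex.pos_iff.1 hω.diag_pos).1
      have hQ : 0 ≤ (∑ a : {i : Fin n // i ≠ j}, ∑ b : {i : Fin n // i ≠ j},
          (W ω a - firResponse (c r) ω a) * psd μ x ω a.1 b.1 *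
          star (W ω b - firResponse (c r) ω b)).re :=
        nonneg_of_mul_nonneg_right ((sq_nonneg _).trans hCS) hii
      have hval : cs μ (x j - firOutput x (c r)) (x i.1) ω
          - (psd μ x ω j i.1 - ∑ a, W ω a * psd μ x ω a.1 i.1)
          = ∑ a, (W ω a - firResponse (c r) ω a) * psd μ x ω a.1 i.1 := by
        rw [(hdiff r i.1).2, (hfir r i.1).2, ← psd_eq_cs]
        simp only [sub_mul, Finset.sum_sub_distrib]
        ring
      rw [hval, ← ENNReal.ofReal_mul (hii.le.trans hre), ← ofReal_norm,
        ← ENNReal.ofReal_pow (norm_nonneg _)]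
      exact ENNReal.ofReal_le_ofReal (hCS.trans (mul_le_mul_of_nonneg_right hre hQ))
    · intro k
      simp only [fun r => (hdiff r i.1).1.integral_cs_mul_exp k]
      have horth := tendsto_integral_mul_of_minimal (hx.memLp j k) (hv k) (hx.memLp i.1 0)
        (fun r => (hfir r i.1).1.memLp_left k) (hlim k) fun r t => by
          -- The tap sits at lag `k`, so at time `k` it multiplies `x_i(0)`, as in the correlation
          -- at lag `k`.
          have := hmin k (c r + Pi.single i (Finsupp.single k t))
          simpa only [firOutput_add_single, sub_self] using this
      have h2 := ((Complex.continuous_ofReal.tendsto 0).comp horth).const_mul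
        (2 * (Real.pi : ℂ))
      rw [Complex.ofReal_zero, mul_zero] at h2
      exact h2
  filter_upwards [hpos, ae_all_iff.2 hzero] with ω hω h0
  exact eq_wienerFilter hω fun i => sub_eq_zero.1 (h0 i)

end LeastSquares

end NetDyn

theorem theorem3 {Ω : Type*} [MeasurableSpace Ω] (μ : Measure Ω) [IsProbabilityMeasure μ]
    {n : ℕ} (N : NetDyn.Network n) (x p : Fin n → ℤ → Ω → ℝ)
    -- the exogenous forcing: zero mean, WSS, mutually uncorrelated, with positive spectral densities
    (hp : NetDyn.IsJWSS μ p) (hp_psd : NetDyn.HasPSD μ p)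
    (hp_mean : ∀ i k, ∫ w, p i k w ∂μ = 0)
    (hp_uncorr : ∀ i j, i ≠ j → ∀ k h, cov[p i k, p j h; μ] = 0)
    (hp_pos : ∀ᵐ ω : ℝ ∂(volume.restrict (Set.Icc (-Real.pi) Real.pi)),
      ∀ i, 0 < (NetDyn.psd μ p ω i i).re)
    -- the states: jointly WSS, driven by `p` through the network
    (hx : NetDyn.IsJWSS μ x) (hx_psd : NetDyn.HasPSD μ x)
    (hdyn : N.Satisfies μ x p)
    (i j : Fin n) (hs : N.StrictSpouses i j) :
    -- at every frequency at which the spectral density of `x` is nonsingular, the phase is `π`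
    (∀ ω ∈ Set.Icc (-Real.pi) Real.pi, (NetDyn.psd μ x ω).PosDef →
      (NetDyn.wienerFilter μ x j ω ⟨i, hs.1⟩).arg = Real.pi) ∧
    -- this applies at every frequency other than `±π` at which the forcing densities are positive
    (∀ ω ∈ Set.Ioo (-Real.pi) Real.pi, (∀ r, 0 < (NetDyn.psd μ p ω r r).re) →
      (NetDyn.psd μ x ω).PosDef) ∧
    -- where `S_j` has no pole and the forcing densities are comparable (for instance, have a common
    -- zero of the same order), the filter extends continuously, with phase `π`
    (∀ ω ∈ Set.Icc (-Real.pi) Real.pi,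
      (ω ∈ Set.Ioo (-Real.pi) Real.pi ∨ ∀ m ∈ Finset.Icc 1 N.l, N.a m j = 0) →
      (∀ r, ∃ c : ℝ, 0 < c ∧
        Tendsto (fun ξ => (NetDyn.psd μ p ξ r r).re / (NetDyn.psd μ p ξ j j).re)
          (𝓝[≠] ω) (𝓝 c)) →
      ∃ c : ℂ, Tendsto (fun ξ => NetDyn.wienerFilter μ x j ξ ⟨i, hs.1⟩) (𝓝[≠] ω) (𝓝 c) ∧
        c.arg = Real.pi) ∧
    -- the solution of the least squares problem has the same response, up to a null set
    (∀ W : ℝ → {i : Fin n // i ≠ j} → ℂ, NetDyn.IsLeastSquaresResponse μ x j W →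
      ∀ᵐ ω : ℝ ∂(volume.restrict (Set.Icc (-Real.pi) Real.pi)),
        W ω = NetDyn.wienerFilter μ x j ω ∧ (W ω ⟨i, hs.1⟩).arg = Real.pi) := by
  have hcont := NetDyn.continuous_psd hx hx_psd
  have hrel : ∀ ω : ℝ, 1 + Complex.exp (-(Complex.I * (ω : ℂ))) ≠ 0 →
      N.dynMatrix ω * NetDyn.psd μ x ω * (N.dynMatrix ω).conjTranspose
        = Matrix.diagonal fun r => ((NetDyn.psd μ p ω r r).re : ℂ) := fun ω hω =>
    (N.dynMatrix_mul_psd_mul hp hp_psd hx hx_psd hdyn hω).trans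
      (NetDyn.Network.psd_eq_diagonal hp hp_psd hp_mean hp_uncorr ω)
  have hd : ∀ r, Continuous fun ω => (NetDyn.psd μ p ω r r).re := fun r =>
    Complex.continuous_re.comp ((NetDyn.continuous_psd hp hp_psd).matrix_elem r r)
  have hphase := fun ω (hω : ω ∈ Set.Icc (-Real.pi) Real.pi) =>
    NetDyn.arg_wienerFilter_eq_pi (d := fun ω r => (NetDyn.psd μ p ω r r).re) hrel hcont
      (continuous_pi hd) hp_pos hs hω
  have hposDef : ∀ ω ∈ Set.Ioo (-Real.pi) Real.pi, (∀ r, 0 < (NetDyn.psd μ p ω r r).re) →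
      (NetDyn.psd μ x ω).PosDef := fun ω hω hpos =>
    (NetDyn.posDef_and_inv_of_congr_diagonal hpos (hrel ω (NetDyn.one_add_exp_ne_zero hω))).1
  have hae : ∀ᵐ ω : ℝ ∂(volume.restrict (Set.Icc (-Real.pi) Real.pi)),
      (NetDyn.psd μ x ω).PosDef := by
    refine NetDyn.ae_of_ae_Ioo ?_
    filter_upwards [hp_pos] with ω h1 h2 using hposDef ω h2 h1
  refine ⟨hphase, hposDef, fun ω _ hpole hratio => ?_, fun W hW => ?_⟩
  · refine NetDyn.exists_tendsto_wienerFilter (d := fun ω r => (NetDyn.psd μ p ω r r).re) hrel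
      (fun ω r => ?_) hs hpole hratio
    exact NetDyn.nonneg_of_ae_pos (hd r)
      (fun ω => congrArg Complex.re (NetDyn.cs_periodic (μ := μ) (p r) (p r) ω))
      (hp_pos.mono fun ω h => h r) ω
  · filter_upwards [hW.ae_eq_wienerFilter hx hx_psd hae, hae,
      ae_restrict_mem measurableSet_Icc] with ω h1 h2 h3
    exact ⟨h1, by rw [h1]; exact hphase ω h3 h2⟩
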